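/- Theorem. Let $p\,q_1\cdots q_k\,r$ be a Conway notation with all entries positive and with first entry and last entry at least $2$ (it may also have only one or two entries), and let $n$ be the sum of the entries. Form the herringbone diagram: start with a crossing $c_1$ and attach crossings $c_2,\dots,c_n$ one after the other, each horizontal crossing twisting the NE and SE posts and each vertical crossing twisting the SW and SE posts of the tangle built so far. The entries are the numbers of crossings in the successive twist sites, the sites are alternately horizontal and vertical, the last one is horizontal, and at every crossing the overstrand has positive slope. Finally join the NW post to the NE post and the SW post to the SE post (numerator closure). The result is a reduced alternating diagram. Assume that it represents a link $L$ with two components. The special edge is the arc from the NW post (at $c_1$) to the NE post (at $c_n$). Label the component containing it $y$ (this component is an unknotted circle without self-crossings) and the other component $x$. Orient the link so that at $c_1$ the understrand, which belongs to $y$, points NW and the overstrand, which belongs to $x$, points NE. This is the standard form. The Alexander matrix has one row for each of the $n$ crossings and one column for each of the $n+2$ regions. If $t$ is the label of the understrand at a crossing and this strand points NW, the entries of the regions at the W, S, E and N corners of the crossing are $t,-t,1,-1$; if it points SE, they are the entries obtained by rotating by $180^\circ$; all other entries are $0$. Delete the columns of the two regions adjacent to the special edge. The determinant of the remaining matrix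 equals $(1-y)\Delta(x,y)$ up to a factor $\pm x^iy^j$, and this determines the Alexander polynomial $\Delta(x,y)$ up to such factors. There is exactly one representative $\Delta(x,y)\in\mathbb Z[x,y]$ which is divisible neither by $x$ nor by $y$ and whose nonzero coefficients are positive in even total degree and negative in odd total degree. Call a twist site monochromatic if all strands at its crossings belong to one component. If the monochromatic twist sites are $m$ in number and have $\hat q_1,\dots,\hat q_m$ crossings, then this normalized $\Delta$ satisfies $$\Delta(-1,0)=\prod_{j=1}^m(\hat q_j+1);$$ in particular $\Delta(-1,0)=1$ if $m=0$. -/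

import Mathlib

/-- The labels of the two components; they are also the variables of the Alexander polynomial. -/
inductive Label
  | x
  | y
  deriving DecidableEq

/-- Every crossing is drawn with its overstrand running from SW to NE (positive slope) and its
understrand from NW to SE. These are the two ends of the understrand. -/
inductive UnderEnd
  | nw
  | se
  deriving DecidableEq

/-- The two ends of the overstrand at a crossing. -/
inductive OverEnd
  | ne
  | sw
  deriving DecidableEq

/-- The two strands at a crossing. -/
inductive Level
  | under
  | over
  deriving DecidableEq

/-- The four corners at a crossing: north lies between the ends NW and NE, and so on. -/
inductive Quadrant
  | north
  | east
  | south
  | west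
  deriving DecidableEq

instance : Fintype UnderEnd := ⟨{.nw, .se}, fun e => by cases e <;> decide⟩

instance : Fintype OverEnd := ⟨{.ne, .sw}, fun e => by cases e <;> decide⟩

instance : Fintype Quadrant :=
  ⟨{.north, .east, .south, .west}, fun q => by cases q <;> decide⟩

/-- The corner on the left of an end of the understrand, as seen when leaving the crossing. -/
def UnderEnd.left : UnderEnd → Quadrant
  | .nw => .west
  | .se => .east

/-- The corner on the right of an end of the understrand, as seen when leaving the crossing. -/
def UnderEnd.right : UnderEnd → Quadrant
  | .nw => .north
  | .se => .south

/-- The corner on the left of an end of the overstrand, as seen when leaving the crossing. -/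
def OverEnd.left : OverEnd → Quadrant
  | .ne => .north
  | .sw => .south

/-- The corner on the right of an end of the overstrand, as seen when leaving the crossing. -/
def OverEnd.right : OverEnd → Quadrant
  | .ne => .east
  | .sw => .west

/-- A connected, reduced, alternating link diagram with `n` crossings and `n + 2` regions.
An edge of an alternating diagram joins an end of an understrand to an end of an overstrand, so
the edges form a bijection `glue` between the two kinds of ends. `region i q` is the region that
contains the corner `q` of the crossing `i`. By Euler's formula a connected diagram on a closed
orientable surface has at most `n + 2` regions, with equality exactly on the sphere; hence the
fields below say that the diagram is spherical and that `region` lists its regions. -/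
structure AlternatingDiagram (n : ℕ) where
  glue : Fin n × UnderEnd → Fin n × OverEnd
  glue_bijective : Function.Bijective glue
  region : Fin n → Quadrant → Fin (n + 2)
  region_surjective : ∀ r, ∃ i q, region i q = r
  /-- The two corners on either side of an edge lie in the same region. -/
  region_left : ∀ u, region u.1 u.2.left = region (glue u).1 (glue u).2.right
  region_right : ∀ u, region u.1 u.2.right = region (glue u).1 (glue u).2.left
  connected : ∀ i j, Relation.EqvGen (fun i j => ∃ e f, glue (i, e) = (j, f)) i j
  /-- No region occupies two corners of one crossing. -/
  reduced : ∀ i, Function.Injective (region i)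

namespace AlternatingDiagram

variable {n : ℕ} (D : AlternatingDiagram n)

/-- Two strands (at possibly different crossings) belong to the same component of the link. -/
def SameComponent : Fin n × Level → Fin n × Level → Prop :=
  Relation.EqvGen fun s t =>
    ∃ u : Fin n × UnderEnd, s = (u.1, Level.under) ∧ t = ((D.glue u).1, Level.over)

end AlternatingDiagram

/-- A labelling of the components of a diagram by `x` and `y`, one label for each component,
together with an orientation. `underNW i` means that the understrand of the crossing `i` points
NW (otherwise it points SE), and `overNE i` that its overstrand points NE (otherwise SW). -/
structure LabelledOrientation {n : ℕ} (D : AlternatingDiagram n) where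
  label : Fin n × Level → Label
  label_eq_iff : ∀ s t, label s = label t ↔ D.SameComponent s t
  underNW : Fin n → Bool
  overNE : Fin n → Bool
  /-- Along every edge, the strand leaves one of the two crossings and enters the other. -/
  coherent : ∀ u : Fin n × UnderEnd,
    (underNW u.1 = true ↔ u.2 = UnderEnd.nw) ↔
      ¬ (overNE (D.glue u).1 = true ↔ (D.glue u).2 = OverEnd.ne)

/-- The normalization of the Alexander polynomial: no negative powers of `x` or `y` occur, but
they do after division by `x` or by `y`; the coefficients of the terms of even total degree are
positive, those of the terms of odd total degree are negative. -/
structure IsNormalized (Δ : MvPolynomial Label ℤ) : Prop where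
  not_x_dvd : ¬ MvPolynomial.X Label.x ∣ Δ
  not_y_dvd : ¬ MvPolynomial.X Label.y ∣ Δ
  sign : ∀ m ∈ Δ.support, 0 < (-1) ^ (m .x + m .y) * Δ.coeff m

namespace LabelledOrientation

open MvPolynomial

variable {n : ℕ} {D : AlternatingDiagram n} (L : LabelledOrientation D)

/-- The Alexander label of a corner. If `t` is the label of the understrand, the two corners on the
left of the understrand carry the dots and the labels `t`, `-t`, the other two carry `1`, `-1`. -/
noncomputable def alexanderLabel (i : Fin n) (q : Quadrant) : MvPolynomial Label ℤ :=
  match L.underNW i, q with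
  | true, .west => X (L.label (i, .under))
  | true, .south => -X (L.label (i, .under))
  | true, .east => 1
  | true, .north => -1
  | false, .east => X (L.label (i, .under))
  | false, .north => -X (L.label (i, .under))
  | false, .west => 1
  | false, .south => -1

/-- The Alexander matrix, with one row for each crossing and one column for each region. -/
noncomputable def alexanderMatrix : Matrix (Fin n) (Fin (n + 2)) (MvPolynomial Label ℤ) :=
  Matrix.of fun i r => ∑ q : Quadrant, if D.region i q = r then L.alexanderLabel i q else 0

/-- `Δ` is the Alexander polynomial, up to factors `± x ^ i * y ^ j`, computed from the special
edge that starts at the end `u` of an understrand. The columns of the two regions on either side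
of the special edge are deleted, and the determinant of the remaining square matrix is
`(1 - t) * Δ` up to such a factor, where `t` is the label of the special edge.
(The order `e` of the remaining columns only affects the sign.) -/
def IsAlexanderPolynomial (u : Fin n × UnderEnd) (Δ : MvPolynomial Label ℤ) : Prop :=
  ∃ (e : Fin n ≃ {r : Fin (n + 2) //
        r ≠ D.region u.1 u.2.left ∧ r ≠ D.region u.1 u.2.right})
    (ε : ℤˣ) (a b c d : ℕ),
    X .x ^ a * X .y ^ b * (L.alexanderMatrix.submatrix id fun j => (e j : Fin (n + 2))).det =
      C (ε : ℤ) * X .x ^ c * X .y ^ d * ((1 - X (L.label (u.1, .under))) * Δ)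

/-- `Δ` is the normalized Alexander polynomial computed from the special edge at `u`. -/
def IsNormalizedAlexanderPolynomial (u : Fin n × UnderEnd) (Δ : MvPolynomial Label ℤ) : Prop :=
  L.IsAlexanderPolynomial u Δ ∧ IsNormalized Δ

end LabelledOrientation

/-! The herringbone diagram. The crossings `0, 1, …, n - 1` are attached one after the other.
`hor i` tells whether the crossing `i` is a horizontal one (it twists the NE and SE posts of the
tangle formed by the crossings before it) or a vertical one (it twists the SW and SE posts).
The crossing `0` is the tangle one starts from. The NW post always stays at the crossing `0`, and
the SE post is always the SE end of the crossing attached last. -/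

namespace Herringbone

variable (n : ℕ) (hor : ℕ → Bool)

/-- The crossing whose NE end is the NE post of the tangle formed by the crossings `0, …, i`. -/
def nePost : ℕ → ℕ
  | 0 => 0
  | i + 1 => if hor (i + 1) then i + 1 else nePost i

/-- The crossing whose SW end is the SW post of the tangle formed by the crossings `0, …, i`. -/
def swPost : ℕ → ℕ
  | 0 => 0
  | i + 1 => if hor (i + 1) then swPost i else i + 1

/-- The over-end which is joined to a given under-end. A horizontal crossing attaches its NW and SW
ends to the NE and SE posts of the tangle before it, a vertical one its NW and NE ends to the
SW and SE posts. In the end the numerator closure joins the NW post to the NE post and the SW post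
to the SE post. -/
def glue : ℕ → UnderEnd → ℕ × OverEnd
  | 0, .nw => (nePost hor (n - 1), .ne)
  | i + 1, .nw => if hor (i + 1) then (nePost hor i, .ne) else (swPost hor i, .sw)
  | i, .se =>
    if i + 1 = n then (swPost hor i, .sw) else if hor (i + 1) then (i + 1, .sw) else (i + 1, .ne)

/-- The region to the east of the tangle formed by the crossings `0, …, i`. A horizontal crossing
`i` creates a new region, with the number `i + 1`; for the last crossing `n - 1` the numerator
closure makes this the unbounded region, with the number `0`, which is also the region to the west
of all the tangles. -/
def eastRegion : ℕ → ℕ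
  | 0 => 1
  | i + 1 => if hor (i + 1) then (if i + 2 = n then 0 else i + 2) else eastRegion i

/-- The region to the south of the tangle formed by the crossings `0, …, i`. The one of the crossing
`0` has the number `n`, and a vertical crossing `i` creates a new one, with the number `i + 1`. -/
def southRegion : ℕ → ℕ
  | 0 => n
  | i + 1 => if hor (i + 1) then southRegion i else i + 2

/-- The region at a corner. The number `n + 1` stands for the region to the north of all the
tangles, which the arc from the NW post to the NE post encloses. -/
def region : ℕ → Quadrant → ℕ
  | i, .east => eastRegion n hor i
  | i, .south => southRegion n hor i
  | 0, .north => n + 1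
  | 0, .west => 0
  | i + 1, .north => if hor (i + 1) then n + 1 else southRegion n hor i
  | i + 1, .west => if hor (i + 1) then eastRegion n hor i else 0

variable {n hor}

theorem nePost_le (i : ℕ) : nePost hor i ≤ i := by
  induction i with
  | zero => simp [nePost]
  | succ i ih => grind [nePost]

theorem swPost_le (i : ℕ) : swPost hor i ≤ i := by
  induction i with
  | zero => simp [swPost]
  | succ i ih => grind [swPost]

theorem nePost_hor (i : ℕ) : nePost hor i = 0 ∨ hor (nePost hor i) = true := by
  induction i with
  | zero => simp [nePost]
  | succ i ih => grind [nePost]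

theorem swPost_hor (i : ℕ) : swPost hor i = 0 ∨ hor (swPost hor i) = false := by
  induction i with
  | zero => simp [swPost]
  | succ i ih => grind [swPost]

theorem le_nePost {i j : ℕ} (hij : i ≤ j) (h : hor i = true) : i ≤ nePost hor j := by
  induction j with
  | zero => omega
  | succ j ih => grind [nePost]

theorem le_swPost {i j : ℕ} (hij : i ≤ j) (h : hor i = false) : i ≤ swPost hor j := by
  induction j with
  | zero => omega
  | succ j ih => grind [swPost]

theorem glue_lt {i : ℕ} (hi : i < n) (e : UnderEnd) : (glue n hor i e).1 < n := by
  have := nePost_le (hor := hor) (n - 1)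
  have := nePost_le (hor := hor) (i - 1)
  have := swPost_le (hor := hor) (i - 1)
  have := swPost_le (hor := hor) i
  rcases i with _ | i <;> cases e <;> grind [glue]

theorem glue_injective (hl : hor (n - 1) = true) {i j : ℕ} {e f : UnderEnd}
    (hi : i < n) (hj : j < n) (h : glue n hor i e = glue n hor j f) : i = j ∧ e = f := by
  have key : ∀ i j, i < n → j < n → i < j → ∀ e f, glue n hor i e ≠ glue n hor j f := by
    intro i j hi hj hij e f
    obtain ⟨j, rfl⟩ : ∃ k, j = k + 1 := ⟨j - 1, by omega⟩
    have h1 := nePost_hor (hor := hor) j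
    have h2 := swPost_hor (hor := hor) j
    have h3 := nePost_hor (hor := hor) (i - 1)
    have h4 := swPost_hor (hor := hor) (i - 1)
    have h5 := nePost_le (hor := hor) (i - 1)
    have h6 := swPost_le (hor := hor) (i - 1)
    have h7 := le_nePost (hor := hor) (i := i) (j := j) (by omega)
    have h8 := le_swPost (hor := hor) (i := i) (j := j) (by omega)
    have h9 := nePost_le (hor := hor) j
    have h10 := swPost_le (hor := hor) j
    have h11 := swPost_hor (hor := hor) (j + 1)
    have h12 := le_swPost (hor := hor) (i := i) (j := j + 1) (by omega)
    have h13 := le_nePost (hor := hor) (i := n - 1) (j := n - 1) le_rfl hl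
    have h14 := nePost_le (hor := hor) (n - 1)
    rcases i with _ | i <;> cases e <;> cases f <;> grind [glue]
  rcases lt_trichotomy i j with hij | rfl | hij
  · exact absurd h (key i j hi hj hij e f)
  · refine ⟨rfl, ?_⟩
    have h3 := nePost_hor (hor := hor) (i - 1)
    have h4 := swPost_hor (hor := hor) i
    have h5 := nePost_le (hor := hor) (i - 1)
    have h6 := swPost_le (hor := hor) (i - 1)
    have h13 := le_nePost (hor := hor) (i := n - 1) (j := n - 1) le_rfl hl
    have h14 := nePost_le (hor := hor) (n - 1)
    rcases i with _ | i <;> cases e <;> cases f <;> grind [glue]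
  · exact absurd h.symm (key j i hj hi hij f e)

theorem eastRegion_lt {i : ℕ} (hi : i < n) : eastRegion n hor i < n + 1 := by
  induction i with
  | zero => grind [eastRegion]
  | succ i ih => grind [eastRegion]

theorem southRegion_lt {i : ℕ} (hi : i < n) : southRegion n hor i < n + 1 := by
  induction i with
  | zero => grind [southRegion]
  | succ i ih => grind [southRegion]

theorem eastRegion_spec {i : ℕ} (hi : i + 1 < n) :
    1 ≤ eastRegion n hor i ∧ eastRegion n hor i ≤ i + 1 ∧
      (eastRegion n hor i = 1 ∨ hor (eastRegion n hor i - 1) = true) := by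
  induction i with
  | zero => grind [eastRegion]
  | succ i ih => grind [eastRegion]

theorem southRegion_spec (i : ℕ) :
    southRegion n hor i = n ∨ (2 ≤ southRegion n hor i ∧ southRegion n hor i ≤ i + 1 ∧
      hor (southRegion n hor i - 1) = false) := by
  induction i with
  | zero => grind [southRegion]
  | succ i ih => grind [southRegion]

theorem region_lt (hn : 2 ≤ n) {i : ℕ} (hi : i < n) (q : Quadrant) :
    region n hor i q < n + 2 := by
  have := eastRegion_lt (hor := hor) hi
  have := southRegion_lt (hor := hor) hi
  have := eastRegion_lt (hor := hor) (n := n) (i := i - 1) (by omega)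
  have := southRegion_lt (hor := hor) (n := n) (i := i - 1) (by omega)
  rcases i with _ | i <;> cases q <;> grind [region]

theorem region_injective (hn : 2 ≤ n) (hl : hor (n - 1) = true) {i : ℕ} (hi : i < n) :
    Function.Injective (region n hor i) := by
  rcases i with _ | i
  · intro p q h
    cases p <;> cases q <;> grind [region, eastRegion, southRegion]
  · have h1 := eastRegion_spec (hor := hor) (n := n) (i := i) hi
    have h2 := southRegion_spec (hor := hor) (n := n) i
    intro p q h
    cases p <;> cases q <;> grind [region, eastRegion, southRegion]

theorem region_surjective (hn : 2 ≤ n) {r : ℕ} (hr : r < n + 2) :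
    ∃ i < n, ∃ q, region n hor i q = r := by
  rcases Nat.lt_or_ge r (n + 1) with h | h
  · rcases Nat.lt_or_ge r n with h' | h'
    · rcases r with _ | _ | r
      · exact ⟨0, by omega, .west, rfl⟩
      · exact ⟨0, by omega, .east, by grind [region, eastRegion]⟩
      · cases hr : hor (r + 1)
        · exact ⟨r + 1, by omega, .south, by grind [region, southRegion]⟩
        · exact ⟨r + 1, by omega, .east, by grind [region, eastRegion]⟩
    · exact ⟨0, by omega, .south, by grind [region, southRegion]⟩
  · exact ⟨0, by omega, .north, by grind [region]⟩

theorem eastRegion_nePost (i : ℕ) : eastRegion n hor (nePost hor i) = eastRegion n hor i := by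
  induction i with
  | zero => rfl
  | succ i ih => grind [eastRegion, nePost]

theorem southRegion_swPost (i : ℕ) : southRegion n hor (swPost hor i) = southRegion n hor i := by
  induction i with
  | zero => rfl
  | succ i ih => grind [southRegion, swPost]

theorem region_north {i : ℕ} (h : i = 0 ∨ hor i = true) : region n hor i .north = n + 1 := by
  cases i <;> grind [region]

theorem region_west {i : ℕ} (h : i = 0 ∨ hor i = false) : region n hor i .west = 0 := by
  cases i <;> grind [region]

theorem region_east (i : ℕ) : region n hor i .east = eastRegion n hor i := by
  cases i <;> rfl

theorem region_south (i : ℕ) : region n hor i .south = southRegion n hor i := by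
  cases i <;> rfl

theorem eastRegion_last (hn : 2 ≤ n) (hl : hor (n - 1) = true) : eastRegion n hor (n - 1) = 0 := by
  obtain ⟨k, rfl⟩ : ∃ k, n = k + 2 := ⟨n - 2, by omega⟩
  grind [eastRegion]

theorem region_left_right (hn : 2 ≤ n) (hl : hor (n - 1) = true) {i : ℕ} (e : UnderEnd) :
    region n hor i e.left = region n hor (glue n hor i e).1 (glue n hor i e).2.right ∧
      region n hor i e.right = region n hor (glue n hor i e).1 (glue n hor i e).2.left := by
  have h1 := eastRegion_last hn hl
  have h2 := nePost_hor (hor := hor) (n - 1)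
  have h3 := nePost_hor (hor := hor) (i - 1)
  have h4 := swPost_hor (hor := hor) (i - 1)
  have h5 := swPost_hor (hor := hor) i
  rcases i with _ | i <;> cases e <;>
    simp only [glue, UnderEnd.left, UnderEnd.right] <;> (try split_ifs) <;>
    simp only [OverEnd.left, OverEnd.right, region_east, region_south, eastRegion_nePost,
      southRegion_swPost] <;>
    grind [region, region_north, region_west, eastRegion, southRegion]

end Herringbone

/-- The herringbone diagram with `n` crossings of the given kinds, the last one horizontal. -/
def herringboneDiagram (n : ℕ) (hor : ℕ → Bool) (hn : 2 ≤ n) (hl : hor (n - 1) = true) :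
    AlternatingDiagram n where
  glue u := (⟨(Herringbone.glue n hor u.1 u.2).1, Herringbone.glue_lt u.1.2 u.2⟩,
    (Herringbone.glue n hor u.1 u.2).2)
  glue_bijective := by
    let E : UnderEnd ≃ OverEnd :=
      ⟨fun | .nw => .ne | .se => .sw, fun | .ne => .nw | .sw => .se,
        fun e => by cases e <;> rfl, fun e => by cases e <;> rfl⟩
    have hinj : Function.Injective fun u : Fin n × UnderEnd =>
        ((⟨(Herringbone.glue n hor u.1 u.2).1, Herringbone.glue_lt u.1.2 u.2⟩,
          (Herringbone.glue n hor u.1 u.2).2) : Fin n × OverEnd) := by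
      rintro ⟨i, e⟩ ⟨j, f⟩ h
      have h' := Herringbone.glue_injective hl i.2 j.2 (e := e) (f := f)
        (Prod.ext (congrArg (fun p : Fin n × OverEnd => (p.1 : ℕ)) h)
          (congrArg (fun p : Fin n × OverEnd => p.2) h))
      exact Prod.ext (Fin.ext h'.1) h'.2
    exact ⟨hinj, (Finite.injective_iff_surjective_of_equiv
      (Equiv.prodCongr (Equiv.refl (Fin n)) E)).1 hinj⟩
  region i q := ⟨Herringbone.region n hor i q, Herringbone.region_lt hn i.2 q⟩
  region_surjective r := by
    obtain ⟨i, hi, q, h⟩ := Herringbone.region_surjective hn r.2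
    exact ⟨⟨i, hi⟩, q, Fin.ext h⟩
  region_left u := Fin.ext (Herringbone.region_left_right hn hl u.2).1
  region_right u := Fin.ext (Herringbone.region_left_right hn hl u.2).2
  connected := by
    have h0 : ∀ (i : ℕ) (hi : i < n), Relation.EqvGen (fun i j : Fin n => ∃ e f,
        ((⟨(Herringbone.glue n hor i e).1, Herringbone.glue_lt i.2 e⟩,
          (Herringbone.glue n hor i e).2) : Fin n × OverEnd) = (j, f)) ⟨0, by omega⟩ ⟨i, hi⟩ := by
      intro i
      induction i with
      | zero => exact fun _ => .refl _
      | succ i ih =>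
        intro hi
        refine .trans _ _ _ (ih (by omega)) (.rel _ _ ⟨.se, _, Prod.ext (Fin.ext ?_) rfl⟩)
        cases i <;> grind [Herringbone.glue]
    exact fun i j => .trans _ _ _ (.symm _ _ (h0 i i.2)) (h0 j j.2)
  reduced i p q h := Herringbone.region_injective hn hl i.2 (congrArg Fin.val h)

/-- A Conway notation with `n` crossings: the numbers of crossings of the twist sites, from the NW
to the SE. All are positive, and the first and the last twist site have at least two crossings. -/
structure ConwayNotation (n : ℕ) extends Composition n where
  pos : 0 < n
  two_le_first : ∀ j : Fin toComposition.length, (j : ℕ) = 0 → 2 ≤ toComposition.blocksFun j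
  two_le_last : ∀ j : Fin toComposition.length,
    (j : ℕ) + 1 = toComposition.length → 2 ≤ toComposition.blocksFun j

namespace ConwayNotation

variable {n : ℕ} (a : ConwayNotation n)

/-- The type of the twist sites. -/
abbrev Site : Type := Fin a.toComposition.length

/-- The number of crossings of a twist site. -/
def crossings (j : a.Site) : ℕ := a.toComposition.blocksFun j

/-- The twist site that contains a crossing. -/
def site (i : Fin n) : a.Site := a.toComposition.index i

/-- Horizontal and vertical twist sites alternate, and the last one is horizontal. -/
abbrev IsHorizontal (j : a.Site) : Prop := Odd (a.toComposition.length - (j : ℕ))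

/-- Whether the crossing `i` lies in a horizontal twist site. -/
def hor (i : ℕ) : Bool :=
  if h : i < n then decide (a.IsHorizontal (a.site ⟨i, h⟩)) else false

theorem two_le (a : ConwayNotation n) : 2 ≤ n := by
  have h : 0 < a.toComposition.length := a.toComposition.length_pos_iff.2 a.pos
  exact (a.two_le_first ⟨0, h⟩ rfl).trans (a.toComposition.blocksFun_le _)

theorem hor_last : a.hor (n - 1) = true := by
  have hn := a.pos
  let i : Fin n := ⟨n - 1, by omega⟩
  have h1 : n - 1 < a.toComposition.sizeUpTo ((a.site i : ℕ) + 1) :=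
    a.toComposition.lt_sizeUpTo_index_succ i
  have h2 := (a.site i).2
  have h3 : (a.site i : ℕ) + 1 = a.toComposition.length := by
    by_contra h
    have h4 := a.toComposition.sizeUpTo_strict_mono (i := (a.site i : ℕ) + 1) (by omega)
    have h5 := a.toComposition.sizeUpTo_le ((a.site i : ℕ) + 1 + 1)
    omega
  have h6 : a.IsHorizontal (a.site i) := ⟨0, by omega⟩
  have h7 : n - 1 < n := by omega
  simpa only [hor, dif_pos h7, decide_eq_true_eq] using h6

/-- The herringbone diagram of the numerator closure of the rational tangle with this Conway
notation. -/
def diagram : AlternatingDiagram n :=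
  herringboneDiagram n a.hor a.two_le a.hor_last

/-- The NW end of the first crossing. The special edge starts there, and separates the unbounded
region from the region that is enclosed by the arc between the NW and the NE post. -/
def specialEnd : Fin n × UnderEnd := (⟨0, a.pos⟩, .nw)

/-- A labelled and oriented herringbone diagram is in standard form if the special edge belongs to
the `y`-component and, at the first crossing, the understrand (which contains the special edge)
points NW and the overstrand belongs to the `x`-component and points NE.
(In a herringbone diagram with two components, the component of the special edge is always a
circle without self-crossings.) -/
structure IsStandardForm (L : LabelledOrientation a.diagram) : Prop where
  label_under : L.label (⟨0, a.pos⟩, .under) = .y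
  label_over : L.label (⟨0, a.pos⟩, .over) = .x
  under_points_nw : L.underNW ⟨0, a.pos⟩ = true
  over_points_ne : L.overNE ⟨0, a.pos⟩ = true

/-- A twist site is monochromatic if all strands at its crossings have the same label. -/
def IsMonochromatic (L : LabelledOrientation a.diagram) (j : a.Site) : Prop :=
  ∃ t : Label, ∀ i : Fin n, a.site i = j → ∀ l : Level, L.label (i, l) = t

end ConwayNotation

/-! Give every region a value in the field of rational functions: `0` to the two deleted regions,
`1` to the region south of the first crossing. Each crossing but the last then determines one new
value: a horizontal crossing that of the region to its east, a vertical one that of the region to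
its south. The resulting vector solves all row equations except the last. By Cramer's rule its image
may replace the last column, which makes the matrix lower triangular with signed monomials on the
rest of the diagonal. So the determinant is, up to a monomial, the value the last east region would
have before the closure (`det_fracMatrix`).

East and south values have opposite signs once `-x`, `-y` are used as variables, so nothing cancels:
they are given by polynomials `E`, `S` with coefficients in `ℕ` (`eastSouth`), up to a common
monomial. This forces the sign pattern of the normalization, and hence existence and uniqueness.

The factor `1 + y` (that is, `1 - y` after the sign change) is found by following the `y`-strand
from the NW post. It divides `E`, `S` or `E + S` according to whether this strand ends at the NE, SW
or SE post (`invariant_eastSouth`). The same induction computes the quotient at `(1, 0)`. While the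
strand avoids `q` successive crossings, the value of `E` or `S` there grows linearly in `q`, and a
factor `q + 1` enters the quotient when the run ends. The closure forces the strand to end at NE,
and the runs are exactly the monochromatic twist sites (`runProduct_last_eq_prod`). -/

open MvPolynomial

/-! ### Sign patterns, normalization up to monomials, and evaluation at `(-1, 0)`. -/

/-- The ring homomorphism that substitutes `-x` and `-y` for the variables. -/
noncomputable def negVars : MvPolynomial Label ℕ →+* MvPolynomial Label ℤ :=
  eval₂Hom (C.comp (Nat.castRingHom ℤ)) fun t => -X t

@[simp] theorem negVars_X (t : Label) : negVars (X t) = -X t := by simp [negVars]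

theorem coeff_negVars (p : MvPolynomial Label ℕ) (m : Label →₀ ℕ) :
    coeff m (negVars p) = (-1) ^ (m .x + m .y) * ((coeff m p : ℕ) : ℤ) := by
  classical
  induction p using MvPolynomial.induction_on generalizing m with
  | C a =>
    have h0 : negVars (C a) = C (a : ℤ) := by simp [negVars]
    rw [h0, coeff_C, coeff_C]
    split_ifs with h
    · subst h; simp
    · simp
  | add p q hp hq => simp [hp, hq, mul_add]
  | mul_X p t hp =>
    rw [map_mul, negVars_X, mul_neg, coeff_neg, coeff_mul_X', coeff_mul_X']
    split_ifs with h
    · rw [hp]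
      have h1 : 1 ≤ m t := Nat.one_le_iff_ne_zero.2 (Finsupp.mem_support_iff.1 h)
      have h2 : m .x + m .y
          = (m - Finsupp.single t 1 : Label →₀ ℕ) Label.x
            + (m - Finsupp.single t 1 : Label →₀ ℕ) Label.y + 1 := by
        cases t <;> simp <;> omega
      rw [h2, pow_succ]; ring
    · simp

/-- Evaluation at `x = 1`, `y = 0`. -/
noncomputable def evalOneZero : MvPolynomial Label ℕ →+* ℕ :=
  eval fun t => if t = .x then 1 else 0

@[simp] theorem evalOneZero_x : evalOneZero (X .x) = 1 := by simp [evalOneZero]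
@[simp] theorem evalOneZero_y : evalOneZero (X .y) = 0 := by simp [evalOneZero]

/-- Evaluation at `x = -1`, `y = 0`. -/
noncomputable def evalNegOneZero : MvPolynomial Label ℤ →+* ℤ :=
  eval fun t => if t = .x then -1 else 0

@[simp] theorem evalNegOneZero_x : evalNegOneZero (X .x) = -1 := by simp [evalNegOneZero]
@[simp] theorem evalNegOneZero_y : evalNegOneZero (X .y) = 0 := by simp [evalNegOneZero]

theorem evalNegOneZero_negVars (p : MvPolynomial Label ℕ) :
    evalNegOneZero (negVars p) = evalOneZero p := by
  have : evalNegOneZero.comp negVars = (Nat.castRingHom ℤ).comp evalOneZero := by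
    ext t
    · simp
    · cases t <;> simp
  exact DFunLike.congr_fun this p

theorem negVars_ne_zero {p : MvPolynomial Label ℕ} (hp : p ≠ 0) : negVars p ≠ 0 := by
  obtain ⟨m, hm⟩ := MvPolynomial.ne_zero_iff.1 hp
  intro h
  have := coeff_negVars p m
  rw [h] at this
  simp [hm] at this

theorem not_X_dvd_X {s t : Label} (h : s ≠ t) :
    ¬ (X s : MvPolynomial Label ℤ) ∣ X t := by
  rw [X_dvd_X]
  tauto

theorem prime_X_label (t : Label) : Prime (X t : MvPolynomial Label ℤ) := X_prime

theorem IsNormalized.ne_zero {Δ : MvPolynomial Label ℤ} (h : IsNormalized Δ) : Δ ≠ 0 := by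
  rintro rfl
  exact h.not_x_dvd (dvd_zero _)

/-- The exponent of a prime that does not divide the cofactors can be read off. -/
theorem exponent_eq_of_pow_mul_eq {R : Type*} [CommRing R] [IsDomain R] {π f g : R} (hπ : Prime π)
    (hf : ¬ π ∣ f) (hg : ¬ π ∣ g) {a b : ℕ} (h : π ^ a * f = π ^ b * g) : a = b := by
  wlog hab : a ≤ b generalizing a b f g
  · exact (this hg hf h.symm (by omega)).symm
  by_contra hne
  obtain ⟨d, rfl⟩ : ∃ d, b = a + (d + 1) := ⟨b - a - 1, by omega⟩
  rw [pow_add, mul_assoc] at h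
  have := mul_left_cancel₀ (pow_ne_zero _ hπ.ne_zero) h
  exact hf (this ▸ (dvd_pow_self _ (by omega)).mul_right _)

theorem isUnit_C_intUnit (ε : ℤˣ) : IsUnit (C (ε : ℤ) : MvPolynomial Label ℤ) :=
  ε.isUnit.map C

theorem not_dvd_pow_mul {R : Type*} [CommRing R] {π ρ f : R} (hπ : Prime π) (h : ¬ π ∣ ρ)
    (hf : ¬ π ∣ f) (a : ℕ) : ¬ π ∣ ρ ^ a * f := fun h' =>
  (hπ.dvd_or_dvd h').elim (fun h'' => h (hπ.dvd_of_dvd_pow h'')) hf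

theorem not_dvd_unit_mul {R : Type*} [CommRing R] {π ρ f : R} (hρ : IsUnit ρ)
    (hf : ¬ π ∣ f) : ¬ π ∣ ρ * f := by
  rwa [hρ.dvd_mul_left]

theorem eq_unit_mul_of_pow_mul_pow_mul_eq {R : Type*} [CommRing R] [IsDomain R] {π ρ η f g : R}
    (hπ : Prime π) (hρ : Prime ρ) (hπρ : ¬ π ∣ ρ) (hρπ : ¬ ρ ∣ π) (hη : IsUnit η)
    (hfπ : ¬ π ∣ f) (hfρ : ¬ ρ ∣ f) (hgπ : ¬ π ∣ g) (hgρ : ¬ ρ ∣ g)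
    {a b c d : ℕ} (h : π ^ a * ρ ^ b * f = η * π ^ c * ρ ^ d * g) : f = η * g := by
  have h1 : a = c := exponent_eq_of_pow_mul_eq (f := ρ ^ b * f) (g := ρ ^ d * (η * g)) hπ
    (not_dvd_pow_mul hπ hπρ hfπ b) (not_dvd_pow_mul hπ hπρ (not_dvd_unit_mul hη hgπ) d)
    (by linear_combination h)
  have h2 : b = d := exponent_eq_of_pow_mul_eq (f := π ^ a * f) (g := π ^ c * (η * g)) hρ
    (not_dvd_pow_mul hρ hρπ hfρ a) (not_dvd_pow_mul hρ hρπ (not_dvd_unit_mul hη hgρ) c)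
    (by linear_combination h)
  subst h1 h2
  refine mul_left_cancel₀ (mul_ne_zero (pow_ne_zero a hπ.ne_zero) (pow_ne_zero b hρ.ne_zero)) ?_
  linear_combination h

/-- Two polynomials that are divisible neither by `x` nor by `y` and agree up to a monomial factor
agree up to sign. -/
theorem eq_sign_mul_of_monomial_mul_eq {f g : MvPolynomial Label ℤ}
    (hfx : ¬ X .x ∣ f) (hfy : ¬ X .y ∣ f) (hgx : ¬ X .x ∣ g) (hgy : ¬ X .y ∣ g)
    {ε : ℤˣ} {a b c d : ℕ} (h : X .x ^ a * X .y ^ b * f = C (ε : ℤ) * X .x ^ c * X .y ^ d * g) :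
    f = C (ε : ℤ) * g :=
  eq_unit_mul_of_pow_mul_pow_mul_eq (prime_X_label .x) (prime_X_label .y)
    (not_X_dvd_X (by decide)) (not_X_dvd_X (by decide)) (isUnit_C_intUnit ε) hfx hfy hgx hgy h

/-- Only a global sign is left undetermined, and the prescribed sign of any single nonzero
coefficient excludes `-1`. -/
theorem IsNormalized.eq_of_monomial_mul_eq {f g : MvPolynomial Label ℤ} (hf : IsNormalized f)
    (hg : IsNormalized g) {ε : ℤˣ} {a b c d : ℕ}
    (h : X .x ^ a * X .y ^ b * f = C (ε : ℤ) * X .x ^ c * X .y ^ d * g) : f = g := by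
  have h1 := eq_sign_mul_of_monomial_mul_eq hf.not_x_dvd hf.not_y_dvd hg.not_x_dvd hg.not_y_dvd h
  rcases Int.units_eq_one_or ε with rfl | rfl
  · simpa using h1
  · exfalso
    obtain ⟨m, hm⟩ := MvPolynomial.ne_zero_iff.1 hf.ne_zero
    have h2 : coeff m f = -coeff m g := by rw [h1]; simp
    have h3 := hf.sign m (mem_support_iff.2 hm)
    have h4 := hg.sign m (mem_support_iff.2 (by rwa [h2, neg_ne_zero] at hm))
    rw [h2] at h3
    linarith

/-- Only the terms free of `y` survive. The sign rule makes each of them positive at `x = -1`, and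
one exists because `y` does not divide `f`. -/
theorem IsNormalized.eval_pos {f : MvPolynomial Label ℤ} (hf : IsNormalized f) :
    0 < evalNegOneZero f := by
  have key : ∀ m : Label →₀ ℕ, (m.prod fun i k => (if i = .x then -1 else 0 : ℤ) ^ k) =
      (-1) ^ m .x * 0 ^ m .y := by
    intro m
    rw [Finsupp.prod_of_support_subset m (s := {Label.x, Label.y})
      (fun t _ => by cases t <;> simp) _ (by simp)]
    simp
  obtain ⟨m₀, hm₀, hy⟩ : ∃ m ∈ f.support, m .y = 0 := by
    by_contra! hcon
    exact hf.not_y_dvd (by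
      rw [MvPolynomial.X_dvd_iff_modMonomial_eq_zero]
      ext m
      rw [coeff_zero]
      by_cases hm : Finsupp.single Label.y 1 ≤ m
      · exact coeff_modMonomial_of_le _ hm
      · rw [coeff_modMonomial_of_not_le _ hm]
        by_contra h
        apply hm
        have := hcon m (mem_support_iff.2 h)
        rw [Finsupp.single_le_iff]
        omega)
  have hterm : ∀ m ∈ f.support, m .y = 0 → 0 < coeff m f * ((-1) ^ m .x * 0 ^ m .y) := by
    intro m hm hy
    have := hf.sign m hm
    rw [hy] at this ⊢
    simpa [mul_comm] using this
  have heval : evalNegOneZero f = ∑ m ∈ f.support, coeff m f * ((-1) ^ m .x * 0 ^ m .y) := by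
    rw [evalNegOneZero, eval_eq]
    exact Finset.sum_congr rfl fun m _ => congrArg _ (key m)
  rw [heval]
  refine Finset.sum_pos' (fun m hm => ?_) ⟨m₀, hm₀, hterm m₀ hm₀ hy⟩
  by_cases h : m .y = 0
  · exact (hterm m hm h).le
  · simp [h]

/-- A nonzero polynomial with nonnegative coefficients has a normalized associate. -/
theorem exists_isNormalized {p : MvPolynomial Label ℕ} (hp : p ≠ 0) :
    ∃ Δ : MvPolynomial Label ℤ, IsNormalized Δ ∧ ∃ (ε : ℤˣ) (c d : ℕ),
      negVars p = C (ε : ℤ) * X .x ^ c * X .y ^ d * Δ := by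
  have hx := prime_X_label .x
  have hy := prime_X_label .y
  obtain ⟨c, f, hf, h1⟩ := WfDvdMonoid.max_power_factor (negVars_ne_zero hp) hx.irreducible
  have hf0 : f ≠ 0 := by rintro rfl; simp at hf
  obtain ⟨d, g, hg, h2⟩ := WfDvdMonoid.max_power_factor hf0 hy.irreducible
  have hgx : ¬ X .x ∣ g := fun h => hf (h2 ▸ h.mul_left _)
  -- Removing `x ^ c * y ^ d` shifts the total degrees by `c + d`; this sign restores the pattern.
  set ε : ℤˣ := (-1) ^ (c + d) with hε
  have hεε : (C (ε : ℤ) : MvPolynomial Label ℤ) * C (ε : ℤ) = 1 := by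
    rw [← C_mul, ← Units.val_mul, Int.units_mul_self]; simp
  have hp' : negVars p = X .x ^ c * X .y ^ d * g := by rw [h1, h2]; ring
  refine ⟨C (ε : ℤ) * g, ⟨not_dvd_unit_mul (isUnit_C_intUnit ε) hgx,
    not_dvd_unit_mul (isUnit_C_intUnit ε) hg, fun m hm => ?_⟩, ε, c, d, ?_⟩
  · have hm' : coeff m g ≠ 0 := by
      intro h
      rw [mem_support_iff, coeff_C_mul, h, mul_zero] at hm
      exact hm rfl
    set m' : Label →₀ ℕ := (Finsupp.single .x c + Finsupp.single .y d) + m with hm'_def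
    have h3 : coeff m' (negVars p) = coeff m g := by
      have : (X .x ^ c * X .y ^ d : MvPolynomial Label ℤ)
          = monomial (Finsupp.single .x c + Finsupp.single .y d) 1 := by
        rw [X_pow_eq_monomial, X_pow_eq_monomial, monomial_mul, mul_one]
      rw [hp', this, hm'_def, coeff_monomial_mul, one_mul]
    have h4 := coeff_negVars p m'
    have h5 : m' .x + m' .y = m .x + m .y + (c + d) := by
      simp [hm'_def]; omega
    rw [h3, h5, pow_add] at h4
    have h6 : (0 : ℤ) < ((coeff m' p : ℕ) : ℤ) := by
      rw [Int.natCast_pos, Nat.pos_iff_ne_zero]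
      rintro h
      rw [h] at h4
      simp at h4
      exact hm' h4
    have h7 : ((-1 : ℤ) ^ (m .x + m .y)) * (-1) ^ (m .x + m .y) = 1 := by
      rw [← mul_pow]; simp
    have h8 : ((-1 : ℤ) ^ (c + d)) * (-1) ^ (c + d) = 1 := by
      rw [← mul_pow]; simp
    rw [coeff_C_mul, h4, hε]
    push_cast
    calc (0 : ℤ) < _ := h6
      _ = (((-1 : ℤ) ^ (m .x + m .y)) * (-1) ^ (m .x + m .y)) *
          (((-1 : ℤ) ^ (c + d)) * (-1) ^ (c + d)) * ((coeff m' p : ℕ) : ℤ) := by rw [h7, h8]; ring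
      _ = _ := by ring
  · rw [hp']
    linear_combination (-(X .x ^ c * X .y ^ d * g)) * hεε

/-- The value at `(-1, 0)` of the normalized associate of a polynomial with nonnegative
coefficients that is not divisible by `y`. -/
theorem IsNormalized.eval_eq {Δ : MvPolynomial Label ℤ} (hΔ : IsNormalized Δ)
    {p : MvPolynomial Label ℕ} (hp : evalOneZero p ≠ 0) {ε : ℤˣ} {a b c d : ℕ}
    (h : X .x ^ a * X .y ^ b * Δ = C (ε : ℤ) * X .x ^ c * X .y ^ d * negVars p) :
    evalNegOneZero Δ = evalOneZero p := by
  have hp0 : p ≠ 0 := by rintro rfl; simp at hp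
  obtain ⟨Δ', hΔ', ε', c', d', h'⟩ := exists_isNormalized hp0
  have h1 : Δ = Δ' := hΔ.eq_of_monomial_mul_eq hΔ' (ε := ε * ε') (c := c + c') (d := d + d')
    (a := a) (b := b) (by rw [h, h', Units.val_mul, C_mul]; ring)
  have h2 := evalNegOneZero_negVars p
  have h3 := hΔ'.eval_pos
  rw [h', map_mul, map_mul, map_mul, map_pow, map_pow, evalNegOneZero_x, evalNegOneZero_y] at h2
  rw [h1]
  -- A positive power of `y` would make the value at `y = 0` vanish, against `hp`.
  have hd : d' = 0 := by
    by_contra hd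
    rw [zero_pow hd] at h2
    simp at h2
    exact hp (by exact_mod_cast h2.symm)
  rw [hd, pow_zero, mul_one] at h2
  have h4 : evalNegOneZero (C (ε' : ℤ)) = (ε' : ℤ) := by simp [evalNegOneZero]
  rw [h4] at h2
  have h5 : (0 : ℤ) ≤ evalOneZero p := Int.natCast_nonneg _
  -- The remaining factor is a sign; it is `+1` because `Δ'` is positive at `(-1, 0)` and `p` is
  -- nonnegative at `(1, 0)`.
  rcases Int.units_eq_one_or ε' with rfl | rfl <;> rcases neg_one_pow_eq_or ℤ c' with hc | hc <;>
    rw [hc] at h2 <;> simp at h2 <;> linarith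

/-! ### The strand from the NW post and the recursion for the region values. -/

/-- The posts of a tangle other than the NW post. -/
inductive Post
  | ne
  | sw
  | se
  deriving DecidableEq

/-- The effect of a horizontal or vertical crossing on the posts. -/
def Post.twist : Bool → Post → Post
  | true, .ne => .se
  | true, .se => .ne
  | true, .sw => .sw
  | false, .sw => .se
  | false, .se => .sw
  | false, .ne => .ne

/-- Whether a horizontal or vertical crossing does not touch a post. -/
def Post.untouched : Bool → Post → Bool
  | true, .sw => true
  | false, .ne => true
  | _, _ => false

namespace Herringbone

/-- The post of the tangle formed by the crossings `0, …, i` that is joined to the NW post by a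
strand of the tangle. -/
def yPost (hor : ℕ → Bool) : ℕ → Post
  | 0 => .se
  | i + 1 => (yPost hor i).twist (hor (i + 1))

/-- Whether the strand from the NW post avoids the crossing `i`. -/
def isMono (hor : ℕ → Bool) (i : ℕ) : Bool :=
  (yPost hor i).untouched (hor i)

/-- The number of crossings at the end of `0, …, i` that the strand from the NW post avoids. -/
def runLength (hor : ℕ → Bool) : ℕ → ℕ
  | 0 => 0
  | i + 1 => if isMono hor (i + 1) then runLength hor i + 1 else 0

/-- The product of `q + 1` over the completed runs of `q` crossings that the strand from the NW post
avoids. -/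
def runProduct (hor : ℕ → Bool) : ℕ → ℕ
  | 0 => 1
  | i + 1 =>
    if isMono hor (i + 1) then runProduct hor i else runProduct hor i * (runLength hor i + 1)

variable {hor : ℕ → Bool}

theorem not_isMono_zero : ¬ isMono hor 0 := by
  unfold isMono yPost
  rcases hor 0 <;> simp [Post.untouched]

/-- An untouched post is fixed by the twist and a touched post goes to a touched one, so the post
before the crossing serves as well as the one after it. -/
theorem isMono_succ (i : ℕ) : isMono hor (i + 1) = (yPost hor i).untouched (hor (i + 1)) := by
  rw [isMono, yPost]
  rcases hor (i + 1) <;> rcases yPost hor i <;> rfl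

theorem isMono_succ_of_eq {i : ℕ} (h : hor (i + 1) = hor i) :
    isMono hor (i + 1) = isMono hor i := by
  rw [isMono_succ, h, isMono]

/-- Horizontal crossings spare only SW and vertical ones only NE, so a run cannot continue across a
change of kind. -/
theorem isMono_succ_of_ne {i : ℕ} (h : hor (i + 1) ≠ hor i) (hm : isMono hor (i + 1)) :
    ¬ isMono hor i := by
  rw [isMono_succ] at hm
  rw [isMono]
  revert h hm
  rcases hor i <;> rcases hor (i + 1) <;> rcases yPost hor i <;> simp [Post.untouched]

theorem runLength_eq_zero {i : ℕ} (h : ¬ isMono hor i) : runLength hor i = 0 := by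
  cases i with
  | zero => rfl
  | succ i => rw [runLength, if_neg h]

theorem runProduct_pos (i : ℕ) : 0 < runProduct hor i := by
  induction i with
  | zero => simp [runProduct]
  | succ i ih => rw [runProduct]; split_ifs <;> positivity

/-- The values of the regions to the east and to the south of the tangles, up to a common factor
and with signs removed. -/
noncomputable def eastSouth (hor : ℕ → Bool) (w r : ℕ → MvPolynomial Label ℕ) :
    ℕ → MvPolynomial Label ℕ × MvPolynomial Label ℕ
  | 0 => (X .y, 1)
  | i + 1 =>
    let v := eastSouth hor w r i
    if hor (i + 1) then (w (i + 1) * (v.1 + v.2), r (i + 1) * v.2)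
    else (w (i + 1) * v.1, r (i + 1) * (v.1 + v.2))

/-- What is known about the values of the regions to the east and to the south. -/
def Invariant (P : Post) (c q : ℕ) (E S : MvPolynomial Label ℕ) : Prop :=
  ∃ A : MvPolynomial Label ℕ, evalOneZero A = c ∧
    match P with
    | .ne => E = (1 + X .y) * A ∧ evalOneZero S = (q + 1) * c
    | .sw => S = (1 + X .y) * A ∧ evalOneZero E = q * c
    | .se => E + S = (1 + X .y) * A ∧ evalOneZero S = c ∧ evalOneZero E = 0 ∧ q = 0

/-- The condition in `hw` says that the `y`-strand passes under the next crossing; it then points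
NW, whence `w = y` and `r = 1`. At all other crossings the understrand belongs to `x`, so `w` and
`r` are `x` and `1` in some order and become `1` at `(1, 0)`. -/
theorem invariant_eastSouth {w r : ℕ → MvPolynomial Label ℕ} {m : ℕ}
    (hw : ∀ i < m, (hor (i + 1) = true ∧ yPost hor i = .ne ∨ hor (i + 1) = false ∧
      yPost hor i = .sw) → w (i + 1) = X .y ∧ r (i + 1) = 1)
    (h1 : ∀ i < m, ¬ (hor (i + 1) = true ∧ yPost hor i = .ne ∨
      hor (i + 1) = false ∧ yPost hor i = .sw) →
        evalOneZero (w (i + 1)) = 1 ∧ evalOneZero (r (i + 1)) = 1) :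
    Invariant (yPost hor m) (runProduct hor m) (runLength hor m) (eastSouth hor w r m).1
      (eastSouth hor w r m).2 := by
  induction m with
  | zero =>
    refine ⟨1, by simp [runProduct], ?_⟩
    simp [yPost, eastSouth, runProduct, runLength, add_comm]
  | succ m ih =>
    obtain ⟨A, hA, h⟩ := ih (fun i hi => hw i (by omega)) fun i hi => h1 i (by omega)
    replace hw := hw m (by omega)
    replace h1 := h1 m (by omega)
    unfold Invariant
    simp only [runProduct, runLength, isMono_succ, yPost, eastSouth]
    generalize (eastSouth hor w r m).1 = E at *
    generalize (eastSouth hor w r m).2 = S at *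
    generalize w (m + 1) = w' at *
    generalize r (m + 1) = r' at *
    generalize runProduct hor m = c at *
    generalize runLength hor m = q at *
    clear ih
    generalize hor (m + 1) = b at *
    generalize yPost hor m = P at *
    -- If `y` passes under, the strand moves to SE, and the new `E + S` is `(1 + y)(E + A)` coming
    -- from SW and `(1 + y)(S + yA)` coming from NE; this closes a run and multiplies `c` by `q +
    -- 1`. In the other four cases `A` only acquires a factor `w` or `r`.
    rcases b <;> rcases P <;>
      simp only [Post.twist, Post.untouched, reduceCtorEq, and_true, and_false, or_false, or_true,
        and_self, true_imp_iff, not_true, not_false_eq_true, false_imp_iff, if_true, if_false, Bool.false_eq_true] at *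
    · obtain ⟨rfl, h⟩ := h
      refine ⟨w' * A, by simp [*], by ring, ?_⟩
      simp [*]; ring
    · obtain ⟨rfl, h⟩ := h
      obtain ⟨rfl, rfl⟩ := hw
      refine ⟨E + A, by simp [*]; ring, by ring, ?_⟩
      simp [*]; ring
    · obtain ⟨h, h2, h3, h4⟩ := h
      refine ⟨r' * A, by simp [*], by rw [h]; ring, ?_⟩
      simp [*]
    · obtain ⟨rfl, h⟩ := h
      obtain ⟨rfl, rfl⟩ := hw
      refine ⟨S + X .y * A, by simp [*]; ring, by ring, ?_⟩
      simp [*]; ring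
    · obtain ⟨rfl, h⟩ := h
      refine ⟨r' * A, by simp [*], by ring, ?_⟩
      simp [*]; ring
    · obtain ⟨h, h2, h3, h4⟩ := h
      refine ⟨w' * A, by simp [*], by rw [h]; ring, ?_⟩
      simp [*]

end Herringbone

/-! ### Runs of avoided crossings are twist sites. -/

namespace ConwayNotation

open Herringbone

variable {n : ℕ} (a : ConwayNotation n)

theorem site_le_site_succ {i : ℕ} (hi : i + 1 < n) :
    (a.site ⟨i, by omega⟩ : ℕ) ≤ a.site ⟨i + 1, hi⟩ := by
  have h1 := a.toComposition.sizeUpTo_index_le ⟨i, by omega⟩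
  have h2 := a.toComposition.lt_sizeUpTo_index_succ ⟨i + 1, hi⟩
  by_contra! h
  have h3 := a.toComposition.monotone_sizeUpTo (Nat.succ_le_of_lt h)
  simp only [site, Nat.succ_eq_add_one, Fin.val_succ] at *
  omega

theorem site_succ_le {i : ℕ} (hi : i + 1 < n) :
    (a.site ⟨i + 1, hi⟩ : ℕ) ≤ a.site ⟨i, by omega⟩ + 1 := by
  have h1 := a.toComposition.sizeUpTo_index_le ⟨i + 1, hi⟩
  have h2 := a.toComposition.lt_sizeUpTo_index_succ ⟨i, by omega⟩
  by_contra! h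
  have h3 := a.toComposition.monotone_sizeUpTo (Nat.succ_le_of_lt h)
  have h4 := (a.site ⟨i + 1, hi⟩).2
  have h5 := a.toComposition.sizeUpTo_strict_mono (i := (a.site ⟨i, by omega⟩ : ℕ) + 1) (by omega)
  simp only [site, Nat.succ_eq_add_one, Fin.val_succ] at *
  omega

theorem site_mono {i j : ℕ} (hj : j < n) (hij : i ≤ j) :
    (a.site ⟨i, by omega⟩ : ℕ) ≤ a.site ⟨j, hj⟩ := by
  induction j with
  | zero => obtain rfl : i = 0 := by omega
            rfl
  | succ j ih =>
    rcases Nat.lt_or_ge i (j + 1) with h | h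
    · exact (ih (by omega) (by omega)).trans (a.site_le_site_succ hj)
    · obtain rfl : i = j + 1 := by omega
      rfl

theorem hor_eq {i : ℕ} (hi : i < n) : a.hor i = decide (a.IsHorizontal (a.site ⟨i, hi⟩)) :=
  dif_pos hi

/-- The site number grows by `0` or `1`, and its parity decides the kind. -/
theorem site_succ_eq_iff {i : ℕ} (hi : i + 1 < n) :
    a.site ⟨i + 1, hi⟩ = a.site ⟨i, by omega⟩ ↔ a.hor (i + 1) = a.hor i := by
  have h1 := a.site_le_site_succ hi
  have h2 := a.site_succ_le hi
  have h3 := (a.site ⟨i + 1, hi⟩).2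
  have h4 := (a.site ⟨i, by omega⟩).2
  rw [a.hor_eq hi, a.hor_eq (by omega : i < n), decide_eq_decide, IsHorizontal, IsHorizontal,
    Nat.odd_iff, Nat.odd_iff, Fin.ext_iff]
  omega

theorem isMono_iff_of_site_eq {i j : ℕ} (hi : i < n) (hj : j < n)
    (h : a.site ⟨i, hi⟩ = a.site ⟨j, hj⟩) : isMono a.hor i = isMono a.hor j := by
  wlog hij : i ≤ j generalizing i j
  · exact (this hj hi h.symm (by omega)).symm
  induction j with
  | zero => obtain rfl : i = 0 := by omega
            rfl
  | succ j ih =>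
    rcases Nat.lt_or_ge i (j + 1) with h' | h'
    · have h1 := a.site_mono (i := i) (j := j) (by omega) (by omega)
      have h2 := a.site_le_site_succ hj
      have h3 : a.site ⟨j + 1, hj⟩ = a.site ⟨j, by omega⟩ := by
        rw [Fin.ext_iff] at h ⊢; omega
      rw [isMono_succ_of_eq ((a.site_succ_eq_iff hj).1 h3)]
      exact ih (by omega) (h.trans h3) (by omega)
    · obtain rfl : i = j + 1 := by omega
      rfl

theorem card_site (j : a.Site) :
    (Finset.univ.filter fun i : Fin n => a.site i = j).card = a.crossings j := by
  have : (Finset.univ.filter fun i : Fin n => a.site i = j)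
      = Finset.univ.map (a.toComposition.embedding j).toEmbedding := by
    ext i
    rw [Finset.mem_filter, Finset.mem_map, and_iff_right (Finset.mem_univ i), eq_comm]
    have := a.toComposition.mem_range_embedding_iff' (j := i) (i := j)
    rw [Set.mem_range] at this
    simpa [site] using this.symm
  rw [this, Finset.card_map, Finset.card_univ, Fintype.card_fin, crossings]

/-- The number of crossings among `0, …, i` that lie in a given twist site. -/
def crossingsUpTo (i : ℕ) (j : a.Site) : ℕ :=
  (Finset.univ.filter fun k : Fin n => (k : ℕ) ≤ i ∧ a.site k = j).card

theorem crossingsUpTo_succ {i : ℕ} (hi : i + 1 < n) (j : a.Site) :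
    a.crossingsUpTo (i + 1) j =
      a.crossingsUpTo i j + if a.site ⟨i + 1, hi⟩ = j then 1 else 0 := by
  unfold crossingsUpTo
  split_ifs with h
  · rw [← Finset.card_insert_of_notMem (a := (⟨i + 1, hi⟩ : Fin n)) (by simp)]
    congr 1
    ext k
    simp only [Finset.mem_filter, Finset.mem_univ, true_and, Finset.mem_insert, Fin.ext_iff]
    constructor
    · rintro ⟨h1, h2⟩
      by_cases h3 : (k : ℕ) = i + 1
      · exact .inl h3
      · exact .inr ⟨by omega, h2⟩
    · rintro (h1 | ⟨h1, h2⟩)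
      · obtain rfl : k = ⟨i + 1, hi⟩ := Fin.ext h1
        exact ⟨le_rfl, by rw [h]⟩
      · exact ⟨by omega, h2⟩
  · rw [add_zero]
    congr 1
    ext k
    simp only [Finset.mem_filter, Finset.mem_univ, true_and]
    refine and_congr_left fun h2 => ⟨fun h1 => ?_, fun h1 => by omega⟩
    by_contra h3
    obtain rfl : k = ⟨i + 1, hi⟩ := Fin.ext (by simp; omega)
    exact h h2

theorem crossingsUpTo_zero (j : a.Site) :
    a.crossingsUpTo 0 j = if a.site ⟨0, a.pos⟩ = j then 1 else 0 := by
  unfold crossingsUpTo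
  have : (Finset.univ.filter fun k : Fin n => (k : ℕ) ≤ 0 ∧ a.site k = j)
      = if a.site ⟨0, a.pos⟩ = j then {⟨0, a.pos⟩} else ∅ := by
    ext k
    split_ifs with h <;> simp only [Finset.mem_filter, Finset.mem_univ, true_and,
      Finset.mem_singleton, Finset.notMem_empty, iff_false, nonpos_iff_eq_zero]
    · refine ⟨fun h1 => Fin.ext h1.1, ?_⟩
      rintro rfl
      exact ⟨rfl, h⟩
    · rintro ⟨h1, h2⟩
      obtain rfl : k = ⟨0, a.pos⟩ := Fin.ext h1
      exact h h2
  rw [this]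
  split_ifs <;> simp

theorem crossingsUpTo_eq_zero {i : ℕ} (hi : i + 1 < n) (h : a.hor (i + 1) ≠ a.hor i) :
    a.crossingsUpTo i (a.site ⟨i + 1, hi⟩) = 0 := by
  rw [crossingsUpTo, Finset.card_eq_zero, Finset.filter_eq_empty_iff]
  rintro k - ⟨h1, h2⟩
  have h3 := a.site_mono (i := k) (j := i) (by omega) h1
  have h4 := a.site_le_site_succ hi
  refine h ((a.site_succ_eq_iff hi).1 (Fin.ext ?_))
  rw [Fin.ext_iff] at h2
  simp only [Fin.eta] at h3
  omega

theorem crossingsUpTo_last (j : a.Site) : a.crossingsUpTo (n - 1) j = a.crossings j := by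
  rw [← card_site, crossingsUpTo]
  congr 1
  ext k
  simp only [Finset.mem_filter, Finset.mem_univ, true_and, and_iff_right_iff_imp]
  omega

theorem runLength_eq_crossingsUpTo {i : ℕ} (hi : i < n) (hm : isMono a.hor i) :
    runLength a.hor i = a.crossingsUpTo i (a.site ⟨i, hi⟩) := by
  induction i with
  | zero => exact absurd hm not_isMono_zero
  | succ i ih =>
    rw [runLength, if_pos hm, a.crossingsUpTo_succ hi, if_pos rfl]
    congr 1
    by_cases h : a.hor (i + 1) = a.hor i
    · rw [(a.site_succ_eq_iff hi).2 h]
      exact ih (by omega) (by rwa [← isMono_succ_of_eq h])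
    · rw [a.crossingsUpTo_eq_zero hi h, runLength_eq_zero (isMono_succ_of_ne h hm)]

/-- The factor `runLength + 1` accounts for the run still in progress, which lies in the current
site. Sites not yet reached contribute `1`. -/
theorem runProduct_mul_eq_prod {M : a.Site → Prop} [DecidablePred M]
    (hM : ∀ i : Fin n, M (a.site i) ↔ isMono a.hor i) {i : ℕ} (hi : i < n) :
    runProduct a.hor i * (runLength a.hor i + 1) = ∏ j with M j, (a.crossingsUpTo i j + 1) := by
  induction i with
  | zero =>
    rw [Finset.prod_eq_one]
    · rfl
    · intro j hj
      have h : a.site ⟨0, a.pos⟩ ≠ j := by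
        rintro rfl
        exact not_isMono_zero ((hM ⟨0, a.pos⟩).1 (Finset.mem_filter.1 hj).2)
      rw [crossingsUpTo_zero, if_neg h, zero_add]
  | succ i ih =>
    specialize ih (by omega)
    have hMi := hM ⟨i + 1, hi⟩
    by_cases hm : isMono a.hor (i + 1)
    · have hj : a.site ⟨i + 1, hi⟩ ∈ Finset.univ.filter M :=
        Finset.mem_filter.2 ⟨Finset.mem_univ _, hMi.2 hm⟩
      have hq := a.runLength_eq_crossingsUpTo hi hm
      rw [crossingsUpTo_succ _ hi, if_pos rfl, runLength, if_pos hm] at hq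
      rw [runProduct, if_pos hm, runLength, if_pos hm]
      rw [← Finset.mul_prod_erase _ _ hj] at ih ⊢
      rw [crossingsUpTo_succ _ hi, if_pos rfl]
      have hrest : ∏ j ∈ (Finset.univ.filter M).erase (a.site ⟨i + 1, hi⟩),
          (a.crossingsUpTo (i + 1) j + 1) =
          ∏ j ∈ (Finset.univ.filter M).erase (a.site ⟨i + 1, hi⟩), (a.crossingsUpTo i j + 1) :=
        Finset.prod_congr rfl fun j hj' => by
          rw [crossingsUpTo_succ _ hi, if_neg (Finset.ne_of_mem_erase hj').symm]
      rw [hrest]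
      have hq' : runLength a.hor i = a.crossingsUpTo i (a.site ⟨i + 1, hi⟩) := by omega
      rw [← hq'] at ih ⊢
      -- Cancel the factor of the current site from the induction hypothesis; only this factor
      -- changes at the crossing `i + 1`.
      have h0 : runProduct a.hor i = ∏ j ∈ (Finset.univ.filter M).erase (a.site ⟨i + 1, hi⟩),
          (a.crossingsUpTo i j + 1) := by
        refine Nat.eq_of_mul_eq_mul_right (Nat.succ_pos (runLength a.hor i)) ?_
        rw [Nat.succ_eq_add_one, ih, mul_comm]
      rw [h0]; ring
    · rw [runProduct, if_neg hm, runLength, if_neg hm, ih, zero_add, mul_one]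
      refine Finset.prod_congr rfl fun j hj => ?_
      rw [crossingsUpTo_succ _ hi, if_neg, add_zero]
      rintro rfl
      exact hm (hMi.1 (Finset.mem_filter.1 hj).2)

end ConwayNotation

/-! ### Labels and orientation in standard form. -/

namespace ConwayNotation

open Herringbone

variable {n : ℕ} {a : ConwayNotation n} (L : LabelledOrientation a.diagram)

/-- The label of a strand, at a crossing given by a natural number. -/
def labelAt (i : ℕ) (l : Level) : Label := if h : i < n then L.label (⟨i, h⟩, l) else .x

/-- Whether the understrand points NW, at a crossing given by a natural number. -/
def underNWAt (i : ℕ) : Bool := if h : i < n then L.underNW ⟨i, h⟩ else true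

/-- Whether the overstrand points NE, at a crossing given by a natural number. -/
def overNEAt (i : ℕ) : Bool := if h : i < n then L.overNE ⟨i, h⟩ else true

theorem labelAt_of_lt {i : ℕ} (h : i < n) (l : Level) : labelAt L i l = L.label (⟨i, h⟩, l) :=
  dif_pos h

theorem labelAt_glue {i : ℕ} (hi : i < n) (e : UnderEnd) :
    labelAt L (glue n a.hor i e).1 .over = labelAt L i .under := by
  rw [labelAt_of_lt L hi, labelAt_of_lt L (glue_lt hi e)]
  exact ((L.label_eq_iff _ _).2 (.rel _ _ ⟨(⟨i, hi⟩, e), rfl, rfl⟩)).symm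

theorem overNEAt_glue {i : ℕ} (hi : i < n) (e : UnderEnd) :
    (underNWAt L i = true ↔ e = .nw) ↔
      ¬ (overNEAt L (glue n a.hor i e).1 = true ↔ (glue n a.hor i e).2 = .ne) := by
  rw [underNWAt, overNEAt, dif_pos hi, dif_pos (glue_lt hi e)]
  exact L.coherent (⟨i, hi⟩, e)

variable {L}

/-- The labels of the strands at the three posts, and the orientation of the `y`-strand. -/
theorem label_posts (hL : a.IsStandardForm L) {i : ℕ} (hi : i < n) :
    labelAt L (nePost a.hor i) .over = (if yPost a.hor i = .ne then .y else .x) ∧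
    labelAt L (swPost a.hor i) .over = (if yPost a.hor i = .sw then .y else .x) ∧
    labelAt L i .under = (if yPost a.hor i = .se then .y else .x) ∧
    match yPost a.hor i with
    | .ne => overNEAt L (nePost a.hor i) = false
    | .sw => overNEAt L (swPost a.hor i) = true
    | .se => underNWAt L i = true := by
  induction i with
  | zero =>
    have h1 := hL.label_under
    have h2 := hL.label_over
    have h3 := hL.under_points_nw
    simp [yPost, nePost, swPost, labelAt, underNWAt, hi, h1, h2, h3]
  | succ i ih =>
    specialize ih (by omega)
    have h1 := labelAt_glue L hi .nw
    have h2 := labelAt_glue L (by omega : i < n) .se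
    have h3 := overNEAt_glue L hi .nw
    have h4 := overNEAt_glue L (by omega : i < n) .se
    have h5 : i + 1 ≠ n := by omega
    have h6 : glue n a.hor i .se =
        if a.hor (i + 1) then (i + 1, .sw) else (i + 1, .ne) := by
      cases i <;> simp [glue, h5]
    rw [h6] at h2 h4
    simp only [glue] at h1 h3
    simp only [yPost, nePost, swPost]
    have hP : yPost a.hor i = .ne ∨ yPost a.hor i = .sw ∨ yPost a.hor i = .se := by
      cases yPost a.hor i <;> simp
    rcases Bool.eq_false_or_eq_true (a.hor (i + 1)) with h | h <;> rcases hP with hP | hP | hP <;>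
      simp_all [Post.twist]

/-- The special edge joins the NW post, labelled `y`, to the NE post, and a post has label `y` only
if the strand from NW ends there. -/
theorem yPost_last (hL : a.IsStandardForm L) : yPost a.hor (n - 1) = .ne := by
  have hn := a.pos
  have h1 := (label_posts hL (i := n - 1) (by omega)).1
  have h2 := labelAt_glue L hn .nw
  have h3 := hL.label_under
  rw [labelAt_of_lt L hn, h3, show (glue n a.hor 0 .nw).1 = nePost a.hor (n - 1) from rfl, h1] at h2
  by_contra h
  simp [h] at h2

/-- Whatever its kind, a new crossing receives the SE post of the previous tangle at an end of its
overstrand. -/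
theorem labelAt_succ_over (hL : a.IsStandardForm L) {i : ℕ} (hi : i + 1 < n) :
    labelAt L (i + 1) .over = if yPost a.hor i = .se then .y else .x := by
  rw [← (label_posts hL (by omega : i < n)).2.2.1, ← labelAt_glue L (by omega : i < n) .se]
  have h5 : i + 1 ≠ n := by omega
  cases i <;> simp only [glue, h5, if_false] <;> split_ifs <;> rfl

theorem labelAt_succ_under (hL : a.IsStandardForm L) {i : ℕ} (hi : i + 1 < n) :
    labelAt L (i + 1) .under =
      if a.hor (i + 1) = true ∧ yPost a.hor i = .ne ∨ a.hor (i + 1) = false ∧ yPost a.hor i = .sw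
      then .y else .x := by
  obtain ⟨h1, h2, -⟩ := label_posts hL (by omega : i < n)
  rw [← labelAt_glue L hi .nw]
  simp only [glue]
  cases h : a.hor (i + 1) <;> simp [h1, h2]

/-- The `y`-strand enters each tangle at its post and leaves at NW. An understrand of `y` at the
next crossing is attached by its NW end, so it must point towards the tangle. -/
theorem underNWAt_succ (hL : a.IsStandardForm L) {i : ℕ} (hi : i + 1 < n)
    (h : labelAt L (i + 1) .under = .y) : underNWAt L (i + 1) = true := by
  rw [labelAt_succ_under hL hi] at h
  have h4 := (label_posts hL (by omega : i < n)).2.2.2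
  have h3 := overNEAt_glue L hi .nw
  simp only [glue] at h3
  generalize a.hor (i + 1) = b at *
  generalize yPost a.hor i = P at *
  rcases b <;> rcases P <;> simp_all

/-- The over- and understrand come from different posts and only one post carries `y`, so equal
labels mean that neither strand is `y`. -/
theorem label_under_eq_over_iff (hL : a.IsStandardForm L) {i : ℕ} (hi : i < n) :
    labelAt L i .under = labelAt L i .over ↔ isMono a.hor i := by
  cases i with
  | zero =>
    have h1 := hL.label_under
    have h2 := hL.label_over
    rw [labelAt_of_lt L hi, labelAt_of_lt L hi, h1, h2]
    simpa using not_isMono_zero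
  | succ i =>
    rw [labelAt_succ_under hL hi, labelAt_succ_over hL hi, isMono_succ]
    generalize a.hor (i + 1) = b at *
    generalize yPost a.hor i = P at *
    rcases b <;> rcases P <;> simp [Post.untouched]

theorem label_eq_x_of_isMono (hL : a.IsStandardForm L) {i : ℕ} (hi : i < n) (h : isMono a.hor i)
    (l : Level) : labelAt L i l = .x := by
  cases i with
  | zero => exact absurd h not_isMono_zero
  | succ i =>
    have h1 := labelAt_succ_under hL hi
    have h2 := labelAt_succ_over hL hi
    rw [isMono_succ] at h
    generalize a.hor (i + 1) = b at *
    generalize yPost a.hor i = P at *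
    rcases b <;> rcases P <;> cases l <;> simp_all [Post.untouched]

theorem isMonochromatic_site_iff (hL : a.IsStandardForm L) (i : Fin n) :
    a.IsMonochromatic L (a.site i) ↔ isMono a.hor i := by
  constructor
  · rintro ⟨t, ht⟩
    rw [← label_under_eq_over_iff hL i.2, labelAt_of_lt L i.2, labelAt_of_lt L i.2, ht i rfl,
      ht i rfl]
  · intro h
    refine ⟨.x, fun k hk l => ?_⟩
    rw [← label_eq_x_of_isMono hL k.2 (by rwa [a.isMono_iff_of_site_eq k.2 i.2 hk]) l,
      labelAt_of_lt L k.2]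

/-- No run is left open at the end: the last crossing is horizontal and the strand ends at NE, which
such a crossing touches. -/
theorem runProduct_last_eq_prod (hL : a.IsStandardForm L) [DecidablePred (a.IsMonochromatic L)] :
    runProduct a.hor (n - 1) = ∏ j with a.IsMonochromatic L j, (a.crossings j + 1) := by
  have hn := a.two_le
  have h := a.runProduct_mul_eq_prod (isMonochromatic_site_iff hL) (i := n - 1) (by omega)
  simp only [crossingsUpTo_last] at h
  rw [← h, runLength_eq_zero, zero_add, mul_one]
  rw [isMono, a.hor_last, yPost_last hL]
  simp [Post.untouched]

end ConwayNotation

/-! ### Signed Laurent monomials as the admissible ambiguity. -/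

/-- The field of rational functions in `x` and `y`. -/
abbrev RatFunXY : Type := FractionRing (MvPolynomial Label ℤ)

/-- The inclusion of the polynomials into the rational functions. -/
noncomputable abbrev toRatFun : MvPolynomial Label ℤ →+* RatFunXY := algebraMap _ _

/-- Signed monomials in `x` and `y`, with exponents in `ℤ`. -/
def IsLaurentMonomial (z : RatFunXY) : Prop :=
  ∃ (ε : ℤˣ) (a b c d : ℕ),
    toRatFun (X .x ^ a * X .y ^ b) * z =
      toRatFun (C (ε : ℤ) * X .x ^ c * X .y ^ d)

namespace IsLaurentMonomial

theorem mul {z z' : RatFunXY} (h : IsLaurentMonomial z) (h' : IsLaurentMonomial z') :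
    IsLaurentMonomial (z * z') := by
  obtain ⟨ε, a, b, c, d, h⟩ := h
  obtain ⟨ε', a', b', c', d', h'⟩ := h'
  refine ⟨ε * ε', a + a', b + b', c + c', d + d', ?_⟩
  have := congrArg₂ (· * ·) h h'
  simp only [map_mul, map_pow, pow_add, Units.val_mul] at this ⊢
  linear_combination this

theorem ne_zero {z : RatFunXY} (h : IsLaurentMonomial z) : z ≠ 0 := by
  obtain ⟨ε, a, b, c, d, h⟩ := h
  rintro rfl
  rw [mul_zero, eq_comm, FaithfulSMul.algebraMap_eq_zero_iff] at h
  exact mul_ne_zero (mul_ne_zero (isUnit_C_intUnit ε).ne_zero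
    (pow_ne_zero _ (prime_X_label _).ne_zero)) (pow_ne_zero _ (prime_X_label _).ne_zero) h

theorem inv {z : RatFunXY} (h : IsLaurentMonomial z) : IsLaurentMonomial z⁻¹ := by
  have hz := h.ne_zero
  obtain ⟨ε, a, b, c, d, h⟩ := h
  have hεε : (C (ε : ℤ) : MvPolynomial Label ℤ) * C (ε : ℤ) = 1 := by
    rw [← C_mul, ← Units.val_mul, Int.units_mul_self]; simp
  replace hεε := congrArg (toRatFun) hεε
  refine ⟨ε, c, d, a, b, mul_right_cancel₀ hz ?_⟩
  rw [mul_assoc, inv_mul_cancel₀ hz, mul_one]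
  simp only [map_mul, map_pow, map_one] at h hεε ⊢
  linear_combination (-toRatFun (C (ε : ℤ))) * h -
    (toRatFun (X .x) ^ c * toRatFun (X .y) ^ d) * hεε

theorem neg {z : RatFunXY} (h : IsLaurentMonomial z) : IsLaurentMonomial (-z) := by
  obtain ⟨ε, a, b, c, d, h⟩ := h
  refine ⟨-ε, a, b, c, d, ?_⟩
  rw [mul_neg, h]
  simp

theorem one : IsLaurentMonomial 1 := ⟨1, 0, 0, 0, 0, by simp⟩

theorem X (t : Label) : IsLaurentMonomial (toRatFun (MvPolynomial.X t)) := by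
  cases t
  · exact ⟨1, 0, 0, 1, 0, by simp⟩
  · exact ⟨1, 0, 0, 0, 1, by simp⟩

theorem prod {ι : Type*} {s : Finset ι} {f : ι → RatFunXY}
    (h : ∀ i ∈ s, IsLaurentMonomial (f i)) : IsLaurentMonomial (∏ i ∈ s, f i) :=
  Finset.prod_induction f _ (fun _ _ => mul) one h

end IsLaurentMonomial

/-- `negVars`, with values in the rational functions. -/
noncomputable def negVarsFrac : MvPolynomial Label ℕ →+* RatFunXY :=
  (toRatFun).comp negVars

theorem negVarsFrac_X (t : Label) : negVarsFrac (X t) = -toRatFun (X t) := by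
  simp [negVarsFrac]

/-! ### Solving the equations of the crossings. -/

namespace Herringbone

/-- The Alexander label of a corner, if the two corners on the side of SW have the labels `w` and
`-w`, and the other two `r` and `-r`. -/
def cornerLabel {R : Type*} [Neg R] (w r : R) : Quadrant → R
  | .west => w
  | .south => -w
  | .east => r
  | .north => -r

variable (n : ℕ) (hor : ℕ → Bool) (w r : ℕ → MvPolynomial Label ℕ)

/-- The common factor left out in `eastSouth`. -/
noncomputable def scale : ℕ → RatFunXY
  | 0 => -1
  | i + 1 => scale i / negVarsFrac (if hor (i + 1) then r (i + 1) else w (i + 1))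

/-- The value of the region to the east of the tangle formed by the crossings `0, …, i`. -/
noncomputable def eastValue (i : ℕ) : RatFunXY :=
  scale hor w r i * negVarsFrac (eastSouth hor w r i).1

/-- The value of the region to the south of the tangle formed by the crossings `0, …, i`. -/
noncomputable def southValue (i : ℕ) : RatFunXY :=
  -(scale hor w r i * negVarsFrac (eastSouth hor w r i).2)

/-- Values of the regions that satisfy the linear equations of all crossings except the last. -/
noncomputable def regionValue (k : ℕ) : RatFunXY :=
  if k = 0 ∨ k = n + 1 then 0
  else if k = n then 1
  else if k = 1 ∨ hor (k - 1) = true then eastValue hor w r (k - 1) else southValue hor w r (k - 1)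

variable {n hor w r}

theorem eastValue_succ_of_ver {i : ℕ} (h : hor (i + 1) = false)
    (hw : negVarsFrac (w (i + 1)) ≠ 0) : eastValue hor w r (i + 1) = eastValue hor w r i := by
  simp only [eastValue, scale, eastSouth, h, Bool.false_eq_true, if_false, map_mul]
  field_simp

theorem southValue_succ_of_hor {i : ℕ} (h : hor (i + 1) = true)
    (hr : negVarsFrac (r (i + 1)) ≠ 0) : southValue hor w r (i + 1) = southValue hor w r i := by
  simp only [southValue, scale, eastSouth, h, if_true, map_mul]
  field_simp

theorem regionValue_eastRegion (hw : ∀ i, negVarsFrac (w i) ≠ 0) {i : ℕ} (hi : i + 1 < n) :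
    regionValue n hor w r (eastRegion n hor i) = eastValue hor w r i := by
  induction i with
  | zero =>
    have h1 : n ≠ 0 := by omega
    have h2 : 1 ≠ n := by omega
    simp [eastRegion, regionValue, h1, h2]
  | succ i ih =>
    cases h : hor (i + 1)
    · rw [eastValue_succ_of_ver h (hw _), ← ih (by omega)]
      simp [eastRegion, h]
    · have h1 : i + 2 ≠ n := by omega
      have h2 : i + 1 ≠ n := by omega
      simp [eastRegion, regionValue, h, h1, h2]

theorem regionValue_southRegion (hr : ∀ i, negVarsFrac (r i) ≠ 0) {i : ℕ} (hi : i + 1 < n) :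
    regionValue n hor w r (southRegion n hor i) = southValue hor w r i := by
  induction i with
  | zero =>
    have h1 : n ≠ 0 := by omega
    simp [southRegion, regionValue, h1, southValue, scale, eastSouth]
  | succ i ih =>
    cases h : hor (i + 1)
    · have h1 : i + 2 ≠ n := by omega
      have h2 : i + 1 ≠ n := by omega
      simp [southRegion, regionValue, h, h1, h2]
    · rw [southValue_succ_of_hor h (hr _), ← ih (by omega)]
      simp [southRegion, h]

/-- The linear equation of a horizontal crossing. -/
theorem eastValue_succ {i : ℕ} (h : hor (i + 1) = true) {W R : RatFunXY}
    (hr : negVarsFrac (r (i + 1)) ≠ 0)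
    (hWR : negVarsFrac (w (i + 1)) * R = -(W * negVarsFrac (r (i + 1)))) :
    W * eastValue hor w r i - W * southValue hor w r i + R * eastValue hor w r (i + 1) = 0 := by
  simp only [eastValue, southValue, scale, eastSouth, h, if_true, map_mul, map_add]
  field_simp
  linear_combination scale hor w r i *
    (negVarsFrac (eastSouth hor w r i).1 + negVarsFrac (eastSouth hor w r i).2) * hWR

/-- The linear equation of a vertical crossing. -/
theorem southValue_succ {i : ℕ} (h : hor (i + 1) = false) {W R : RatFunXY}
    (hw : negVarsFrac (w (i + 1)) ≠ 0)
    (hWR : negVarsFrac (w (i + 1)) * R = -(W * negVarsFrac (r (i + 1)))) :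
    -(W * southValue hor w r (i + 1)) + R * eastValue hor w r i - R * southValue hor w r i = 0 := by
  simp only [eastValue, southValue, scale, eastSouth, h, Bool.false_eq_true, if_false, map_mul,
    map_add]
  field_simp
  linear_combination scale hor w r i *
    (negVarsFrac (eastSouth hor w r i).1 + negVarsFrac (eastSouth hor w r i).2) * hWR

theorem sum_quadrant {M : Type*} [AddCommMonoid M] (f : Quadrant → M) :
    ∑ q, f q = f .north + f .east + f .south + f .west := by
  have : (Finset.univ : Finset Quadrant) = {.north, .east, .south, .west} := rfl
  rw [this]
  simp [add_assoc]

/-- `hWR` says that `-W / R` is the quotient of the sign-changed `w` and `r`; this one relation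
turns the recursion of `eastSouth` into the crossing equations. The values at the crossing `0` are
`y` to the east and `1` to the south. -/
theorem sum_cornerLabel_mul_regionValue {W R : ℕ → RatFunXY}
    (hw : ∀ i, negVarsFrac (w i) ≠ 0) (hr : ∀ i, negVarsFrac (r i) ≠ 0)
    (hWR : ∀ i, negVarsFrac (w i) * R i = -(W i * negVarsFrac (r i)))
    (hw0 : w 0 = X .y) (hr0 : r 0 = 1) {i : ℕ} (hi : i + 1 < n) :
    ∑ q, cornerLabel (W i) (R i) q * regionValue n hor w r (region n hor i q) = 0 := by
  have hn0 : n ≠ 0 := by omega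
  have h0 : regionValue n hor w r 0 = 0 := by simp [regionValue]
  have hn : regionValue n hor w r (n + 1) = 0 := by simp [regionValue]
  have he := regionValue_eastRegion (r := r) (hor := hor) hw hi
  have hs := regionValue_southRegion (w := w) (hor := hor) hr hi
  rw [sum_quadrant, region_east, region_south, he, hs]
  cases i with
  | zero =>
    have := hWR 0
    rw [hw0, hr0, map_one, mul_one] at this
    simp only [region, hn, h0, cornerLabel, eastValue, southValue, scale, eastSouth, map_one]
    linear_combination -this
  | succ i =>
    have he' := regionValue_eastRegion (r := r) (hor := hor) hw (by omega : i + 1 < n)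
    have hs' := regionValue_southRegion (w := w) (hor := hor) hr (by omega : i + 1 < n)
    cases h : hor (i + 1)
    · simp only [region, h, Bool.false_eq_true, if_false, h0, hs', cornerLabel]
      rw [eastValue_succ_of_ver h (hw _)]
      linear_combination southValue_succ h (hw _) (hWR (i + 1))
    · simp only [region, h, if_true, hn, he', cornerLabel]
      rw [southValue_succ_of_hor h (hr _)]
      linear_combination eastValue_succ h (hr _) (hWR (i + 1))

/-- The equation would hold if the east region had the value `eastValue`. The closure makes it the
unbounded region, with value `0`, and the missing term is the defect. -/
theorem sum_cornerLabel_mul_regionValue_last {W R : ℕ → RatFunXY} (hn2 : 2 ≤ n)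
    (hl : hor (n - 1) = true)
    (hw : ∀ i, negVarsFrac (w i) ≠ 0) (hr : ∀ i, negVarsFrac (r i) ≠ 0)
    (hWR : ∀ i, negVarsFrac (w i) * R i = -(W i * negVarsFrac (r i))) :
    ∑ q, cornerLabel (W (n - 1)) (R (n - 1)) q * regionValue n hor w r (region n hor (n - 1) q) =
      -(R (n - 1) * eastValue hor w r (n - 1)) := by
  obtain ⟨i, rfl⟩ : ∃ k, n = k + 2 := ⟨n - 2, by omega⟩
  have hl' : hor (i + 1) = true := hl
  have h0 : regionValue (i + 2) hor w r 0 = 0 := by simp [regionValue]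
  have hn : regionValue (i + 2) hor w r (i + 2 + 1) = 0 := by simp [regionValue]
  have he' := regionValue_eastRegion (r := r) (hor := hor) hw (by omega : i + 1 < i + 2)
  have hs' := regionValue_southRegion (w := w) (hor := hor) hr (by omega : i + 1 < i + 2)
  rw [sum_quadrant]
  simp only [show i + 2 - 1 = i + 1 from rfl, region, eastRegion, southRegion, hl', if_true, h0, hn,
    he', hs', cornerLabel]
  linear_combination eastValue_succ hl' (hr _) (hWR (i + 1))

/-- The region `k + 1` is created by the crossing `k`, so no earlier crossing meets it. The number
`n` is excluded because it belongs to the region south of the crossing `0`. -/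
theorem region_ne_of_lt (hn : 2 ≤ n) {i k : ℕ} (hi : i < k) (hk : k + 1 < n) (q : Quadrant) :
    region n hor i q ≠ k + 1 := by
  have h1 := eastRegion_spec (hor := hor) (n := n) (i := i) (by omega)
  have h2 := southRegion_spec (hor := hor) (n := n) i
  have h3 := eastRegion_spec (hor := hor) (n := n) (i := i - 1) (by omega)
  have h4 := southRegion_spec (hor := hor) (n := n) (i - 1)
  rcases i with _ | i <;> cases q <;> grind [region]

/-- The only corner at the crossing `i` in the region with the number `i + 1`. -/
def newCorner (hor : ℕ → Bool) (i : ℕ) : Quadrant :=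
  if i = 0 ∨ hor i = true then .east else .south

theorem region_eq_succ_iff (hn : 2 ≤ n) (hl : hor (n - 1) = true) {i : ℕ} (hi : i + 1 < n)
    (q : Quadrant) : region n hor i q = i + 1 ↔ q = newCorner hor i := by
  have h : region n hor i (newCorner hor i) = i + 1 := by
    cases i with
    | zero => rfl
    | succ i =>
      have h1 : i + 2 ≠ n := by omega
      cases h : hor (i + 1) <;> simp [newCorner, h, region, eastRegion, southRegion, h1]
  rw [← h]
  exact (region_injective hn hl (by omega)).eq_iff

end Herringbone

/-! ### The determinant of the Alexander matrix. -/

namespace ConwayNotation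

open Herringbone

variable {n : ℕ} (a : ConwayNotation n)

/-- The bounded regions, those with the numbers `1, …, n`, in increasing order. -/
def boundedRegions : Fin n ≃ {r : Fin (n + 2) //
    r ≠ a.diagram.region a.specialEnd.1 a.specialEnd.2.left ∧
      r ≠ a.diagram.region a.specialEnd.1 a.specialEnd.2.right} where
  toFun j := ⟨⟨j + 1, by omega⟩, by
    constructor <;> rw [Ne, Fin.ext_iff]
    · change ¬ ((j : ℕ) + 1 = 0)
      omega
    · change ¬ ((j : ℕ) + 1 = n + 1)
      omega⟩
  invFun r := ⟨(r : ℕ) - 1, by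
    have h1 := r.2.1
    have h2 := r.2.2
    have h3 := r.1.2
    rw [Ne, Fin.ext_iff] at h1 h2
    change ¬ ((r.1 : ℕ) = 0) at h1
    change ¬ ((r.1 : ℕ) = n + 1) at h2
    omega⟩
  left_inv j := Fin.ext (by simp)
  right_inv r := by
    have h1 := r.2.1
    rw [Ne, Fin.ext_iff] at h1
    change ¬ ((r.1 : ℕ) = 0) at h1
    refine Subtype.ext (Fin.ext ?_)
    simp only
    omega

variable {a} (L : LabelledOrientation a.diagram)

/-- The label at the corners on the side of SW, at a crossing given by a natural number. -/
noncomputable def westLabel (R : Type*) [CommSemiring R] (i : ℕ) : MvPolynomial Label R :=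
  if underNWAt L i then X (labelAt L i .under) else 1

/-- The label at the corners on the side of NE, at a crossing given by a natural number. -/
noncomputable def eastLabel (R : Type*) [CommSemiring R] (i : ℕ) : MvPolynomial Label R :=
  if underNWAt L i then 1 else X (labelAt L i .under)

theorem alexanderLabel_eq (i : Fin n) (q : Quadrant) :
    L.alexanderLabel i q = cornerLabel (westLabel L ℤ i) (eastLabel L ℤ i) q := by
  have h1 := labelAt_of_lt L i.2 .under
  have h2 : underNWAt L i = L.underNW i := dif_pos i.2
  unfold LabelledOrientation.alexanderLabel westLabel eastLabel
  rw [h1, h2]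
  cases L.underNW i <;> cases q <;> rfl

/-- Exactly one of the two labels is a variable, so the sign change produces a single minus sign. -/
theorem negVars_westLabel_mul (i : ℕ) :
    negVarsFrac (westLabel L ℕ i) * toRatFun (eastLabel L ℤ i) =
      -(toRatFun (westLabel L ℤ i) * negVarsFrac (eastLabel L ℕ i)) := by
  unfold westLabel eastLabel
  split_ifs <;> simp [negVarsFrac_X]

theorem isLaurentMonomial_westLabel (i : ℕ) :
    IsLaurentMonomial (toRatFun (westLabel L ℤ i)) ∧
      IsLaurentMonomial (toRatFun (eastLabel L ℤ i)) ∧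
      IsLaurentMonomial (negVarsFrac (westLabel L ℕ i)) ∧
      IsLaurentMonomial (negVarsFrac (eastLabel L ℕ i)) := by
  have h := IsLaurentMonomial.X (labelAt L i .under)
  have h1 := IsLaurentMonomial.one
  unfold westLabel eastLabel
  split_ifs <;> simp only [map_one, negVarsFrac_X] <;>
    exact ⟨‹_›, ‹_›, by simp [*, h.neg], by simp [*, h.neg]⟩

theorem isLaurentMonomial_scale (i : ℕ) :
    IsLaurentMonomial (scale a.hor (westLabel L ℕ) (eastLabel L ℕ) i) := by
  induction i with
  | zero => exact IsLaurentMonomial.one.neg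
  | succ i ih =>
    obtain ⟨-, -, h1, h2⟩ := isLaurentMonomial_westLabel L (i + 1)
    rw [scale, div_eq_mul_inv]
    refine ih.mul (IsLaurentMonomial.inv ?_)
    split_ifs
    · exact h2
    · exact h1

/-- The Alexander matrix of the bounded regions, over the rational functions. -/
noncomputable def fracMatrix : Matrix (Fin n) (Fin n) RatFunXY :=
  (L.alexanderMatrix.submatrix id fun j => (a.boundedRegions j : Fin (n + 2))).map toRatFun

theorem fracMatrix_apply (i j : Fin n) :
    fracMatrix L i j = ∑ q : Quadrant, if region n a.hor i q = j + 1 then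
      cornerLabel (toRatFun (westLabel L ℤ i)) (toRatFun (eastLabel L ℤ i)) q else 0 := by
  simp only [fracMatrix, Matrix.map_apply, Matrix.submatrix_apply, id,
    LabelledOrientation.alexanderMatrix, Matrix.of_apply, map_sum]
  refine Finset.sum_congr rfl fun q _ => ?_
  rw [alexanderLabel_eq, apply_ite toRatFun, map_zero]
  refine if_congr Fin.ext_iff ?_ rfl
  cases q <;> simp [cornerLabel]

/-- Since `v` vanishes on the deleted regions, their columns may be put back and the sum taken over
the four corners. -/
theorem fracMatrix_mulVec {v : ℕ → RatFunXY} (h0 : v 0 = 0) (hn : v (n + 1) = 0) (i : Fin n) :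
    (fracMatrix L).mulVec (fun j => v (j + 1)) i = ∑ q,
      cornerLabel (toRatFun (westLabel L ℤ i)) (toRatFun (eastLabel L ℤ i)) q *
        v (region n a.hor i q) := by
  simp only [Matrix.mulVec, dotProduct, fracMatrix_apply, Finset.sum_mul]
  rw [Finset.sum_comm]
  refine Finset.sum_congr rfl fun q _ => ?_
  have hlt := region_lt (hor := a.hor) a.two_le i.2 q
  generalize region n a.hor i q = ρ at *
  by_cases h : ρ = 0 ∨ ρ = n + 1
  · rw [show v ρ = 0 by rcases h with rfl | rfl <;> assumption, mul_zero]
    refine Finset.sum_eq_zero fun j _ => ?_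
    rw [if_neg (by omega), zero_mul]
  · rw [Finset.sum_eq_single (⟨ρ - 1, by omega⟩ : Fin n)]
    · have : ρ - 1 + 1 = ρ := by omega
      simp only [this, if_true]
    · intro j _ hj
      rw [if_neg, zero_mul]
      rw [Ne, Fin.ext_iff] at hj
      simp only at hj
      omega
    · simp

theorem isLaurentMonomial_fracMatrix_diag {i : Fin n} (hi : (i : ℕ) + 1 < n) :
    IsLaurentMonomial (fracMatrix L i i) := by
  obtain ⟨h1, h2, -, -⟩ := isLaurentMonomial_westLabel L i
  rw [fracMatrix_apply]
  simp only [region_eq_succ_iff a.two_le a.hor_last hi, Finset.sum_ite_eq', Finset.mem_univ, if_true]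
  unfold newCorner
  split_ifs
  · exact h2
  · exact h1.neg

theorem det_fracMatrix (hL : a.IsStandardForm L) :
    ∃ z, IsLaurentMonomial z ∧ (fracMatrix L).det =
      z * negVarsFrac (eastSouth a.hor (westLabel L ℕ) (eastLabel L ℕ) (n - 1)).1 := by
  have hn := a.two_le
  have hlab : labelAt L 0 .under = .y := (labelAt_of_lt L a.pos _).trans hL.label_under
  have hup : underNWAt L 0 = true := (dif_pos a.pos).trans hL.under_points_nw
  have hw0 : westLabel L ℕ 0 = X .y := by rw [westLabel, hup, hlab]; rfl
  have hr0 : eastLabel L ℕ 0 = 1 := by rw [eastLabel, hup]; rfl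
  have hw : ∀ i, negVarsFrac (westLabel L ℕ i) ≠ 0 := fun i =>
    (isLaurentMonomial_westLabel L i).2.2.1.ne_zero
  have hr : ∀ i, negVarsFrac (eastLabel L ℕ i) ≠ 0 := fun i =>
    (isLaurentMonomial_westLabel L i).2.2.2.ne_zero
  set v := regionValue n a.hor (westLabel L ℕ) (eastLabel L ℕ) with hv
  set A := fracMatrix L with hA
  let l : Fin n := ⟨n - 1, by omega⟩
  -- The last column belongs to the region `n`, south of the crossing `0`, where the value was
  -- normalized.
  have hvl : v (l + 1) = 1 := by
    have h1 : n - 1 + 1 = n := by omega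
    have h2 : n ≠ 0 := by omega
    simp [hv, l, regionValue, h1, h2]
  have hmul := fracMatrix_mulVec L (v := v) (by simp [hv, regionValue]) (by simp [hv, regionValue])
  have hlt : ∀ i : Fin n, i ≠ l → (i : ℕ) + 1 < n := fun i hi => by
    rw [Ne, Fin.ext_iff] at hi
    simp only [l] at hi
    omega
  have hcol : ∀ i : Fin n, i ≠ l → A.mulVec (fun j => v (j + 1)) i = 0 := fun i hi => by
    rw [hmul i]
    exact sum_cornerLabel_mul_regionValue (W := fun i => toRatFun (westLabel L ℤ i))
      (R := fun i => toRatFun (eastLabel L ℤ i)) hw hr (negVars_westLabel_mul L) hw0 hr0 (hlt i hi)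
  have hlast : A.mulVec (fun j => v (j + 1)) l = -(toRatFun (eastLabel L ℤ (n - 1)) *
      eastValue a.hor (westLabel L ℕ) (eastLabel L ℕ) (n - 1)) := by
    rw [hmul l]
    exact sum_cornerLabel_mul_regionValue_last (W := fun i => toRatFun (westLabel L ℤ i))
      (R := fun i => toRatFun (eastLabel L ℤ i)) hn a.hor_last hw hr (negVars_westLabel_mul L)
  -- Cramer's rule: the new determinant is `det A` times the entry of the vector at `l`, which is
  -- `1`.
  have hdet : A.det = (A.updateCol l (A.mulVec fun j => v (j + 1))).det := by
    rw [← Matrix.cramer_apply, Matrix.cramer_eq_adjugate_mulVec, Matrix.mulVec_mulVec,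
      Matrix.adjugate_mul, Matrix.smul_mulVec, Matrix.one_mulVec, Pi.smul_apply, hvl, smul_eq_mul,
      mul_one]
  have htri : (A.updateCol l (A.mulVec fun j => v (j + 1))).BlockTriangular OrderDual.toDual := by
    intro i j hij
    replace hij : i < j := hij
    have hil : i ≠ l := fun h => by
      have := j.2
      rw [h, Fin.lt_def] at hij
      simp only [l] at hij
      omega
    by_cases hj : j = l
    · rw [hj, Matrix.updateCol_self, hcol i hil]
    · rw [Matrix.updateCol_ne hj, hA, fracMatrix_apply]
      exact Finset.sum_eq_zero fun q _ => if_neg (region_ne_of_lt hn hij (hlt j hj) q)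
  rw [Matrix.det_of_isLowerTriangular _ htri, ← Finset.mul_prod_erase _ _ (Finset.mem_univ l),
    Matrix.updateCol_self, hlast] at hdet
  refine ⟨-(toRatFun (eastLabel L ℤ (n - 1)) *
    scale a.hor (westLabel L ℕ) (eastLabel L ℕ) (n - 1) * ∏ i ∈ Finset.univ.erase l,
      A.updateCol l (A.mulVec fun j => v (j + 1)) i i), ?_, ?_⟩
  · refine (((isLaurentMonomial_westLabel L (n - 1)).2.1.mul (isLaurentMonomial_scale L _)).mul
      (IsLaurentMonomial.prod fun i hi => ?_)).neg
    have hil := Finset.ne_of_mem_erase hi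
    rw [Matrix.updateCol_ne hil]
    exact isLaurentMonomial_fracMatrix_diag L (hlt i hil)
  · rw [hdet, eastValue]
    ring

/-- As the `y`-strand ends at NE, `invariant_eastSouth` gives `E = (1 + y) A`, and the sign change
turns `1 + y` into `1 - y`. -/
theorem det_submatrix_alexanderMatrix (hL : a.IsStandardForm L) :
    ∃ A : MvPolynomial Label ℕ, evalOneZero A = runProduct a.hor (n - 1) ∧
      ∃ (ε : ℤˣ) (b c d e : ℕ), X .x ^ b * X .y ^ c *
        (L.alexanderMatrix.submatrix id fun j => (a.boundedRegions j : Fin (n + 2))).det =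
          C (ε : ℤ) * X .x ^ d * X .y ^ e * ((1 - X .y) * negVars A) := by
  have hn := a.two_le
  have hinv := invariant_eastSouth (hor := a.hor) (w := westLabel L ℕ) (r := eastLabel L ℕ)
    (m := n - 1) (fun i hi h => ?_) (fun i hi h => ?_)
  · obtain ⟨A, hA, h⟩ := hinv
    rw [yPost_last hL] at h
    obtain ⟨z, ⟨ε, b, c, d, e, hz⟩, hdet⟩ := det_fracMatrix L hL
    refine ⟨A, hA, ε, b, c, d, e, IsFractionRing.injective _ RatFunXY ?_⟩
    change toRatFun _ = toRatFun _
    rw [map_mul, RingHom.map_det]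
    change _ * (fracMatrix L).det = _
    rw [hdet, h.1, ← mul_assoc, hz, negVarsFrac, RingHom.comp_apply, ← map_mul]
    simp [sub_eq_add_neg]
  · have h1 := labelAt_succ_under hL (by omega : i + 1 < n)
    rw [if_pos h] at h1
    have h2 := underNWAt_succ hL (by omega) h1
    rw [westLabel, eastLabel, h1, h2]
    exact ⟨rfl, rfl⟩
  · have h1 := labelAt_succ_under hL (by omega : i + 1 < n)
    rw [if_neg h] at h1
    rw [westLabel, eastLabel, h1]
    split_ifs <;> simp

theorem det_submatrix_alexanderMatrix_equiv (e e' : Fin n ≃ {r : Fin (n + 2) //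
    r ≠ a.diagram.region a.specialEnd.1 a.specialEnd.2.left ∧
      r ≠ a.diagram.region a.specialEnd.1 a.specialEnd.2.right}) :
    ∃ ε : ℤˣ, (L.alexanderMatrix.submatrix id fun j => (e j : Fin (n + 2))).det =
      C (ε : ℤ) * (L.alexanderMatrix.submatrix id fun j => (e' j : Fin (n + 2))).det := by
  refine ⟨Equiv.Perm.sign (e.trans e'.symm), ?_⟩
  have := Matrix.det_permute' (e.trans e'.symm)
    (L.alexanderMatrix.submatrix id fun j => (e' j : Fin (n + 2)))
  rw [Matrix.submatrix_submatrix] at this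
  convert this using 2
  · ext i j
    simp
  · simp

/-- The Alexander polynomials are the associates of a polynomial with nonnegative coefficients in
`-x` and `-y`. -/
theorem exists_isAlexanderPolynomial_iff (hL : a.IsStandardForm L) :
    ∃ A : MvPolynomial Label ℕ, evalOneZero A = runProduct a.hor (n - 1) ∧
      ∀ Δ : MvPolynomial Label ℤ, L.IsAlexanderPolynomial a.specialEnd Δ ↔
        ∃ (ε : ℤˣ) (b c d e : ℕ), X .x ^ b * X .y ^ c * Δ =
          C (ε : ℤ) * X .x ^ d * X .y ^ e * negVars A := by
  obtain ⟨A, hA, ε, b, c, d, e, h⟩ := det_submatrix_alexanderMatrix L hL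
  have hy : (1 - X .y : MvPolynomial Label ℤ) ≠ 0 := by
    intro h
    have := congrArg evalNegOneZero h
    simp at this
  have hsq : ∀ ε : ℤˣ, (C (ε : ℤ) : MvPolynomial Label ℤ) * C (ε : ℤ) = 1 := fun ε => by
    rw [← C_mul, ← Units.val_mul, Int.units_mul_self]; simp
  refine ⟨A, hA, fun Δ => ?_⟩
  rw [LabelledOrientation.IsAlexanderPolynomial,
    show L.label (a.specialEnd.1, .under) = .y from hL.label_under]
  constructor
  · rintro ⟨o, ε₁, b₁, c₁, d₁, e₁, h₁⟩
    obtain ⟨ε₂, h₂⟩ := det_submatrix_alexanderMatrix_equiv L o a.boundedRegions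
    rw [h₂] at h₁
    generalize (L.alexanderMatrix.submatrix id fun j => (a.boundedRegions j : Fin (n + 2))).det
      = δ at *
    -- Eliminate the determinant by cross-multiplying the two identities with each other's
    -- monomials, then cancel `1 - y`.
    refine ⟨ε₁ * ε₂ * ε, b + d₁, c + e₁, d + b₁, e + c₁, mul_left_cancel₀ hy ?_⟩
    have h3 := hsq ε₁
    simp only [Units.val_mul, C_mul, pow_add]
    linear_combination (C (ε₁ : ℤ) * C (ε₂ : ℤ) * X .x ^ b₁ * X .y ^ c₁) * h
      - (C (ε₁ : ℤ) * X .x ^ b * X .y ^ c) * h₁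
      - (X .x ^ b * X .y ^ c * X .x ^ d₁ * X .y ^ e₁ * (1 - X .y) * Δ) * h3
  · rintro ⟨ε₁, b₁, c₁, d₁, e₁, h₁⟩
    refine ⟨a.boundedRegions, ε₁ * ε, b + d₁, c + e₁, d + b₁, e + c₁, ?_⟩
    generalize (L.alexanderMatrix.submatrix id fun j => (a.boundedRegions j : Fin (n + 2))).det
      = δ at *
    have h3 := hsq ε₁
    simp only [Units.val_mul, C_mul, pow_add]
    linear_combination (X .x ^ d₁ * X .y ^ e₁) * h
      - (C (ε₁ : ℤ) * C (ε : ℤ) * X .x ^ d * X .y ^ e * (1 - X .y)) * h₁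
      - (C (ε : ℤ) * X .x ^ d * X .y ^ e * X .x ^ d₁ * X .y ^ e₁ * (1 - X .y) * negVars A) * h3

end ConwayNotation

/-! ### Existence, uniqueness and the value at `(-1, 0)`. -/

theorem mainTheorem1 {n : ℕ} (a : ConwayNotation n) (L : LabelledOrientation a.diagram)
    (hL : a.IsStandardForm L) :
    (∃! Δ : MvPolynomial Label ℤ, L.IsNormalizedAlexanderPolynomial a.specialEnd Δ) ∧
    ∀ Δ : MvPolynomial Label ℤ, L.IsNormalizedAlexanderPolynomial a.specialEnd Δ →
      MvPolynomial.eval (fun | .x => -1 | .y => 0) Δ =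
        open Classical in
        ∏ j : a.Site with a.IsMonochromatic L j, ((a.crossings j : ℤ) + 1) := by
  classical
  obtain ⟨A, hA, hiff⟩ := a.exists_isAlexanderPolynomial_iff L hL
  -- A product of factors `q + 1` is never zero; so `A` is nonzero and its value at `y = 0` survives
  -- normalization.
  have hA0 : evalOneZero A ≠ 0 := hA ▸ (Herringbone.runProduct_pos _).ne'
  have hA1 : A ≠ 0 := by rintro rfl; simp at hA0
  obtain ⟨Δ₀, hΔ₀, ε₀, d₀, e₀, h₀⟩ := exists_isNormalized hA1
  have hεε : (C (ε₀ : ℤ) : MvPolynomial Label ℤ) * C (ε₀ : ℤ) = 1 := by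
    rw [← C_mul, ← Units.val_mul, Int.units_mul_self]; simp
  refine ⟨⟨Δ₀, ⟨(hiff Δ₀).2 ⟨ε₀, d₀, e₀, 0, 0, ?_⟩, hΔ₀⟩, ?_⟩, ?_⟩
  · rw [h₀]
    linear_combination (-(X .x ^ d₀ * X .y ^ e₀ * Δ₀)) * hεε
  · rintro Δ ⟨h1, h2⟩
    obtain ⟨ε, b, c, d, e, h⟩ := (hiff Δ).1 h1
    exact h2.eq_of_monomial_mul_eq hΔ₀ (ε := ε * ε₀) (a := b) (b := c) (c := d + d₀) (d := e + e₀)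
      (by rw [h, h₀, Units.val_mul, C_mul]; ring)
  · rintro Δ ⟨h1, h2⟩
    obtain ⟨ε, b, c, d, e, h⟩ := (hiff Δ).1 h1
    have heval : MvPolynomial.eval (fun | .x => -1 | .y => 0) Δ = evalNegOneZero Δ := by
      rw [evalNegOneZero]
      congr 2
      funext t
      cases t <;> rfl
    refine heval.trans ((h2.eval_eq hA0 h).trans ?_)
    rw [hA, ConwayNotation.runProduct_last_eq_prod hL]
    push_cast
    rfl
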